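/- Let $k$ be a field, let $\mathcal O$ be a commutative ring and $\mathcal O\to k$ a ring homomorphism. Let ${}_{\mathcal O}\mathsf H/k$ be the category of noetherian henselian local $\mathcal O$-algebras $S$ with residue field $k$ (given with an $\mathcal O$-algebra surjection $S\to k$), with $\mathcal O$-algebra maps over $k$. A map $S\to T$ of noetherian henselian local rings is \emph{algebraic} if $T$ is the henselisation of a finite type $S$-algebra in a maximal ideal whose residue field is that of $S$. A square of henselian local rings is \emph{cocartesian} if it identifies the new corner with the henselised tensor product (henselised in the ideal generated by the maximal ideals of the two factors). Let $A$ be a Gorenstein local algebraic $k$-algebra and $N$ a finite $A$-module. For $S$ in ${}_{\mathcal O}\mathsf H/k$ let $\mathrm{Def}_{(A,N)}(S)$ be the set of isomorphism classes of pairs $(S\to T,\mathcal N)$, where $T$ is a flat algebraic $S$-algebra with a map $T\to A$ making the square over $S\to k$ cocartesian ($T\otimes_S k\cong A$), and $\mathcal N$ is an $S$-flat finite $T$-module with a $T$-linear map $\mathcal N\to N$ inducing $A\otimes_T\mathcal N\cong N$; isomorphisms are over $S$ and commute with the maps to $A$ and $N$. For $S\to S_0$ a class is sent to its base change, the target of a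 cocartesian map of deformations over $S\to S_0$. For $S$ in ${}_k\mathsf H/k$ let $\mathrm{Def}^A_N(S)$ be the set of isomorphism classes of such $\mathcal N$ for the trivial deformation $T=A\tilde\otimes_k S$, the henselisation of $A\otimes_k S$ in the ideal $\mathfrak m_A(A\otimes_kS)+\mathfrak m_S(A\otimes_kS)$. Let $0\to L\to M\xrightarrow{\;p\;}N\to 0$ be the minimal maximal Cohen-Macaulay (MCM) approximation of $N$: $M$ is a maximal Cohen-Macaulay module, $L$ is a finite module of finite injective dimension, and every endomorphism $g$ of $M$ with $pg=p$ is an automorphism. Suppose $\operatorname{depth}N=\dim A-1$. Then every deformation $(S\to T,\mathcal N)$ of $(A,N)$ has a minimal MCM approximation $0\to\mathcal L\to\mathcal M\to\mathcal N\to0$ by $S$-flat finite $T$-modules (with $A\otimes_T\mathcal M$ maximal Cohen-Macaulay, $A\otimes_T\mathcal L$ of finite injective dimension, and $\mathcal M\to\mathcal N$ right minimal) together with a map $\mathcal M\to M$ which makes $\mathcal M$ a deformation of $M$ and commutes with $\mathcal N\to N$ and $p$, and $(T,\mathcal N)\mapsto(T,\mathcal M)$ induces well-defined natural maps of functors $$\sigma_M:\mathrm{Def}_{(A,N)}\to\mathrm{Def}_{(A,M)}\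 \text{ on }{}_{\mathcal O}\mathsf H/k,\qquad \sigma^A_M:\mathrm{Def}^A_N\to\mathrm{Def}^A_M\ \text{ on }{}_k\mathsf H/k .$$ Moreover, $\sigma_M$ and $\sigma_M^A$ are smooth: for $\sigma:F\to G$ either of the two and every surjection $S\to S_0$ in the respective category, the map $F(S)\to F(S_0)\times_{G(S_0)}G(S)$ is surjective. -/

import Mathlib

open TensorProduct CategoryTheory

universe w v u

namespace CMDef

/-! ### Depth, maximal Cohen-Macaulay modules, finite injective dimension, Gorenstein rings -/

/-- The depth of a finite module `M` over a noetherian local ring `A`: the supremum of the lengths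
of the `M`-regular sequences in the maximal ideal. For `M ≠ 0` finite, weakly regular sequences in
the maximal ideal are regular by Nakayama's lemma; the zero module gets depth `∞`. -/
noncomputable def depth (A : Type u) [CommRing A] [IsLocalRing A]
    (M : Type u) [AddCommGroup M] [Module A M] : ℕ∞ :=
  ⨆ (rs : List A) (_ : (∀ r ∈ rs, r ∈ IsLocalRing.maximalIdeal A) ∧
    RingTheory.Sequence.IsWeaklyRegular M rs), (rs.length : ℕ∞)

/-- Maximal Cohen-Macaulay modules over a noetherian local ring: finite modules with
`depth M = dim A`, and the zero module. (A nonzero finite module satisfies `depth M ≤ dim A`.) -/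
def IsMCM (A : Type u) [CommRing A] [IsLocalRing A]
    (M : Type u) [AddCommGroup M] [Module A M] : Prop :=
  Module.Finite A M ∧ ringKrullDim A ≤ ((depth A M : ℕ∞) : WithBot ℕ∞)

/-- Finite modules of finite injective dimension. -/
def IsFID (A : Type u) [CommRing A] (L : Type u) [AddCommGroup L] [Module A L] : Prop :=
  Module.Finite A L ∧ ∃ n : ℕ, HasInjectiveDimensionLE (ModuleCat.of A L) n

/-- A noetherian local ring is Gorenstein if it has finite injective dimension over itself. -/
def IsGorensteinLocal (A : Type u) [CommRing A] : Prop :=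
  IsLocalRing A ∧ IsNoetherianRing A ∧
    ∃ n : ℕ, HasInjectiveDimensionLE (ModuleCat.of A A) n

/-- `p : M → N` is right minimal: every endomorphism `g` of `M` with `p g = p` is an
automorphism. -/
def IsRightMinimal {A : Type u} [CommRing A] {M N : Type u} [AddCommGroup M] [Module A M]
    [AddCommGroup N] [Module A N] (p : M →ₗ[A] N) : Prop :=
  ∀ g : M →ₗ[A] M, p ∘ₗ g = p → Function.Bijective g

/-- `0 → ker p → M → N → 0` is a minimal maximal Cohen-Macaulay approximation of `N`: `M` is
maximal Cohen-Macaulay, `p` is surjective, `ker p` is finite of finite injective dimension, and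
`p` is right minimal. -/
structure IsMinimalMCMApprox {A : Type u} [CommRing A] [IsLocalRing A] {M N : Type u}
    [AddCommGroup M] [Module A M] [AddCommGroup N] [Module A N] (p : M →ₗ[A] N) : Prop where
  mcm : IsMCM A M
  surjective : Function.Surjective p
  fid : IsFID A (LinearMap.ker p)
  minimal : IsRightMinimal p

/-! ### Henselisation, algebraic maps, cocartesian squares of henselian local rings -/

/-- The `R`-algebra `T` is the henselisation of `R` in the prime ideal `m`, i.e. the initial
henselian local ring `T` with a map from `R` such that the maximal ideal contracts to `m`. -/
def IsHenselisationAt (R : Type u) [CommRing R] (m : Ideal R)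
    (T : Type u) [CommRing T] [HenselianLocalRing T] [Algebra R T] : Prop :=
  (IsLocalRing.maximalIdeal T).comap (algebraMap R T) = m ∧
  ∀ (B : Type u) [CommRing B] [HenselianLocalRing B] (ψ : R →+* B),
    (IsLocalRing.maximalIdeal B).comap ψ = m →
      ∃! χ : T →+* B, IsLocalHom χ ∧ χ.comp (algebraMap R T) = ψ

/-- `T` is an algebraic `S`-algebra: the henselisation of a finite type `S`-algebra `R` in a
maximal ideal `m` whose residue field is the residue field of `S`. -/
def IsAlgebraicMap (S : Type u) [CommRing S] (T : Type u) [CommRing T] [HenselianLocalRing T]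
    [Algebra S T] : Prop :=
  ∃ (R : Type u) (_ : CommRing R) (_ : Algebra S R) (_ : Algebra R T) (_ : IsScalarTower S R T)
    (m : Ideal R), Algebra.FiniteType S R ∧ m.IsMaximal ∧
      Function.Surjective ((Ideal.Quotient.mk m).comp (algebraMap S R)) ∧
      IsHenselisationAt R m T

/-- The square with `g : S₁ → S₂`, `h₁ : S₁ → T₁`, `h₂ : S₂ → T₂`, `f : T₁ → T₂` is cocartesian
for henselian local rings and local homomorphisms, i.e. `T₂` is the henselisation of
`T₁ ⊗_{S₁} S₂` in the ideal generated by the maximal ideals of `T₁` and `S₂`, expressed through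
its universal property. -/
def IsCocartesianSquare {S₁ S₂ T₁ T₂ : Type u} [CommRing S₁] [CommRing S₂] [CommRing T₁]
    [CommRing T₂] (g : S₁ →+* S₂) (h₁ : S₁ →+* T₁) (h₂ : S₂ →+* T₂) (f : T₁ →+* T₂) : Prop :=
  f.comp h₁ = h₂.comp g ∧ IsLocalHom f ∧ IsLocalHom h₂ ∧
  ∀ (B : Type u) [CommRing B] [HenselianLocalRing B] (a : T₁ →+* B) (b : S₂ →+* B),
    IsLocalHom a → IsLocalHom b → a.comp h₁ = b.comp g →
      ∃! c : T₂ →+* B, IsLocalHom c ∧ c.comp f = a ∧ c.comp h₂ = b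

/-- A map of modules `α : X₁ → X₂`, linear over `f : T₁ → T₂`, is cocartesian if the induced map
`T₂ ⊗_{T₁} X₁ → X₂` is an isomorphism. -/
def IsCocartesianHom {T₁ T₂ : Type u} [CommRing T₁] [CommRing T₂] (f : T₁ →+* T₂)
    {X₁ X₂ : Type u} [AddCommGroup X₁] [Module T₁ X₁] [AddCommGroup X₂] [Module T₂ X₂]
    (α : X₁ →ₛₗ[f] X₂) : Prop :=
  letI : Algebra T₁ T₂ := f.toAlgebra
  letI : Module T₁ X₂ := Module.compHom X₂ f
  haveI : IsScalarTower T₁ T₂ X₂ := ⟨fun a b x => mul_smul (f a) b x⟩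
  IsBaseChange T₂
    ({ toFun := α, map_add' := α.map_add, map_smul' := α.map_smulₛₗ } : X₁ →ₗ[T₁] X₂)

/-! ### The base category -/

/-- Objects of the category of noetherian henselian local `O`-algebras `S` with residue
field `k`, given with the surjection `S → k`. -/
structure Base (O : Type v) [CommRing O] (k : Type u) [Field k] [Algebra O k] where
  carrier : Type u
  [commRing : CommRing carrier]
  [henselian : HenselianLocalRing carrier]
  [noetherian : IsNoetherianRing carrier]
  [algebra : Algebra O carrier]
  aug : carrier →ₐ[O] k
  aug_surjective : Function.Surjective aug

attribute [instance] Base.commRing Base.henselian Base.noetherian Base.algebra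

/-- Morphisms of base rings: `O`-algebra maps commuting with the maps to `k`
(such maps are automatically local). -/
structure BaseHom {O : Type v} [CommRing O] {k : Type u} [Field k] [Algebra O k]
    (S S₀ : Base O k) where
  hom : S.carrier →ₐ[O] S₀.carrier
  aug_comp : S₀.aug.comp hom = S.aug

/-! ### Deformations -/

section Deformations

variable {O : Type v} [CommRing O] {k : Type u} [Field k] [Algebra O k]
variable (A : Type u) [CommRing A] [Algebra k A]

/-- A deformation `S → T` of the `k`-algebra `A` to `S`: a flat and algebraic map of noetherian
henselian local rings with a map `T → A` which makes the square over `S → k` cocartesian. -/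
structure AlgDef (S : Base O k) where
  T : Type u
  [commRing : CommRing T]
  [henselian : HenselianLocalRing T]
  [noetherian : IsNoetherianRing T]
  [algebra : Algebra S.carrier T]
  [flat : Module.Flat S.carrier T]
  algebraic : IsAlgebraicMap S.carrier T
  [toFibre : Algebra T A]
  cocartesian : IsCocartesianSquare S.aug.toRingHom (algebraMap S.carrier T) (algebraMap k A)
    (algebraMap T A)

attribute [instance] AlgDef.commRing AlgDef.henselian AlgDef.noetherian AlgDef.algebra
  AlgDef.flat AlgDef.toFibre

variable {A}

/-- A deformation of the `A`-module `N` over the deformation `S → T` of `A`: an `S`-flat finite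
`T`-module `X` with a cocartesian map `X → N`. -/
structure ModDef {S : Base O k} (t : AlgDef A S) (N : Type u) [AddCommGroup N] [Module A N] where
  X : Type u
  [addCommGroup : AddCommGroup X]
  [module : Module t.T X]
  [moduleBase : Module S.carrier X]
  [tower : IsScalarTower S.carrier t.T X]
  [finite : Module.Finite t.T X]
  [flat : Module.Flat S.carrier X]
  toFibre : X →ₛₗ[algebraMap t.T A] N
  cocartesian : IsCocartesianHom (algebraMap t.T A) toFibre

attribute [instance] ModDef.addCommGroup ModDef.module ModDef.moduleBase ModDef.tower
  ModDef.finite ModDef.flat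

variable {N M : Type u} [AddCommGroup N] [Module A N] [AddCommGroup M] [Module A M]

/-- `e : T ≅ T'` and some `X ≅ X'` give an isomorphism of the deformations `(T, X)`, `(T', X')`
of `(A, N)` to `S`. -/
def IsIsoOver {S : Base O k} {t t' : AlgDef A S} (e : t.T ≃+* t'.T)
    (x : ModDef t N) (x' : ModDef t' N) : Prop :=
  (∀ s, e (algebraMap S.carrier t.T s) = algebraMap S.carrier t'.T s) ∧
  (∀ a, algebraMap t'.T A (e a) = algebraMap t.T A a) ∧
  ∃ φ : x.X ≃+ x'.X, (∀ (a : t.T) (y : x.X), φ (a • y) = e a • φ y) ∧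
    ∀ y, x'.toFibre (φ y) = x.toFibre y

theorem IsIsoOver.refl {S : Base O k} {t : AlgDef A S} (x : ModDef t N) :
    IsIsoOver (RingEquiv.refl t.T) x x :=
  ⟨fun _ => rfl, fun _ => rfl, AddEquiv.refl _, fun _ _ => rfl, fun _ => rfl⟩

theorem IsIsoOver.symm {S : Base O k} {t t' : AlgDef A S} {e : t.T ≃+* t'.T}
    {x : ModDef t N} {x' : ModDef t' N} (h : IsIsoOver e x x') : IsIsoOver e.symm x' x := by
  obtain ⟨h₁, h₂, φ, h₃, h₄⟩ := h
  refine ⟨fun s => ?_, fun a => ?_, φ.symm, fun a y => ?_, fun y => ?_⟩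
  · rw [← h₁ s, e.symm_apply_apply]
  · rw [← h₂, e.apply_symm_apply]
  · rw [AddEquiv.symm_apply_eq, h₃, e.apply_symm_apply, φ.apply_symm_apply]
  · rw [← h₄, φ.apply_symm_apply]

theorem IsIsoOver.trans {S : Base O k} {t t' t'' : AlgDef A S} {e : t.T ≃+* t'.T}
    {e' : t'.T ≃+* t''.T} {x : ModDef t N} {x' : ModDef t' N} {x'' : ModDef t'' N}
    (h : IsIsoOver e x x') (h' : IsIsoOver e' x' x'') : IsIsoOver (e.trans e') x x'' := by
  obtain ⟨h₁, h₂, φ, h₃, h₄⟩ := h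
  obtain ⟨h₁', h₂', φ', h₃', h₄'⟩ := h'
  refine ⟨fun s => ?_, fun a => ?_, φ.trans φ', fun a y => ?_, fun y => ?_⟩
  · simp [h₁, h₁']
  · simp [h₂, h₂']
  · simp [h₃, h₃']
  · simp [h₄, h₄']

/-- `φ : T → T₀` and some `X → X₀` give a map of deformations `(T, X) → (T₀, X₀)` over
`S → S₀`: the square of rings and the map of modules are cocartesian, and both commute with the
maps to `(A, N)`. -/
def IsMapOver {S S₀ : Base O k} (f : BaseHom S S₀) {t : AlgDef A S} {t₀ : AlgDef A S₀}
    (φ : t.T →+* t₀.T) (x : ModDef t N) (x₀ : ModDef t₀ N) : Prop :=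
  IsCocartesianSquare f.hom.toRingHom (algebraMap S.carrier t.T) (algebraMap S₀.carrier t₀.T) φ ∧
  (algebraMap t₀.T A).comp φ = algebraMap t.T A ∧
  ∃ α : x.X →ₛₗ[φ] x₀.X, IsCocartesianHom φ α ∧ ∀ y, x₀.toFibre (α y) = x.toFibre y

/-- `π : Y → X` is a minimal MCM approximation of the deformation `X` of `N` which extends
the minimal MCM approximation `p : M → N`, where `Y` is a deformation of `M`, both over `S → T`.
`Y` is in `MCM` since its closed fibre is a maximal Cohen-Macaulay module (it is `S`-flat),
`ker π` is `S`-flat and its closed fibre has finite injective dimension, and the square formed by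
`π`, `p` and the maps to the closed fibres commutes. -/
structure IsApproxMap {S : Base O k} [IsLocalRing A] (p : M →ₗ[A] N) {t : AlgDef A S}
    (x : ModDef t N) (y : ModDef t M) (π : y.X →ₗ[t.T] x.X) : Prop where
  mcm : IsMCM A (A ⊗[t.T] y.X)
  surjective : Function.Surjective π
  ker_flat : Module.Flat S.carrier (LinearMap.ker π)
  ker_fid : IsFID A (A ⊗[t.T] (LinearMap.ker π))
  minimal : IsRightMinimal π
  comm : ∀ z, p (y.toFibre z) = x.toFibre (π z)

/-! ### The deformation functor of the pair `(A, N)` -/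

/-- Deformations of the pair `(A, N)` to `S`. -/
structure PairDef (N : Type u) [AddCommGroup N] [Module A N] (S : Base O k) where
  alg : AlgDef A S
  mod : ModDef alg N

instance PairDef.setoid (S : Base O k) : Setoid (PairDef (A := A) N S) where
  r ξ ξ' := ∃ e : ξ.alg.T ≃+* ξ'.alg.T, IsIsoOver e ξ.mod ξ'.mod
  iseqv :=
    ⟨fun ξ => ⟨_, IsIsoOver.refl ξ.mod⟩, fun ⟨_, h⟩ => ⟨_, h.symm⟩,
      fun ⟨_, h⟩ ⟨_, h'⟩ => ⟨_, h.trans h'⟩⟩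

/-- The set `Def_{(A,N)}(S)` of isomorphism classes of deformations of `(A, N)` to `S`. -/
def DefPair (A : Type u) [CommRing A] [Algebra k A] (N : Type u) [AddCommGroup N] [Module A N]
    (S : Base O k) : Type (u + 1) :=
  Quotient (PairDef.setoid (A := A) (N := N) S)

/-- The class of a deformation. -/
def DefPair.mk {S : Base O k} (ξ : PairDef (A := A) N S) : DefPair A N S :=
  Quotient.mk _ ξ

/-- The (graph of the) map `Def_{(A,N)}(S) → Def_{(A,N)}(S₀)` induced by `f : S → S₀`: it sends
the class of `ξ` to the class of the target of a cocartesian map from `ξ` lying over `f`. -/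
def DefPair.Maps {S S₀ : Base O k} (f : BaseHom S S₀) (a : DefPair A N S)
    (a₀ : DefPair A N S₀) : Prop :=
  ∃ (ξ : PairDef (A := A) N S) (ξ₀ : PairDef (A := A) N S₀),
    DefPair.mk ξ = a ∧ DefPair.mk ξ₀ = a₀ ∧
      ∃ φ : ξ.alg.T →+* ξ₀.alg.T, IsMapOver f φ ξ.mod ξ₀.mod

/-- The maps `σ_M : Def_{(A,N)}(S) → Def_{(A,M)}(S)` induced by the minimal MCM approximation
`p : M → N`: every deformation of `(A, N)` has a minimal MCM approximation extending `p`, and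
`σ_M` takes the class of `(T, X)` to the class of `(T, Y)` for any such approximation `Y → X`. -/
def IsInducedPair [IsLocalRing A] (p : M →ₗ[A] N)
    (σ : ∀ S : Base O k, DefPair A N S → DefPair A M S) : Prop :=
  ∀ (S : Base O k) (t : AlgDef A S) (x : ModDef t N),
    (∃ (y : ModDef t M) (π : y.X →ₗ[t.T] x.X), IsApproxMap p x y π) ∧
    ∀ (y : ModDef t M) (π : y.X →ₗ[t.T] x.X), IsApproxMap p x y π →
      σ S (DefPair.mk ⟨t, x⟩) = DefPair.mk ⟨t, y⟩

end Deformations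

/-! ### The deformation functor of the module `N`, where `A` deforms trivially -/

section Trivial

variable {k : Type u} [Field k] (A : Type u) [CommRing A] [Algebra k A]

/-- The trivial deformation `S → T` of `A`, where `T` is the henselisation of `A ⊗_k S`: a
deformation with a section `A → T` of `T → A` such that the square of the maps from `k` to `S`,
`A` and `T` is cocartesian. -/
structure TrivAlgDef (S : Base k k) extends AlgDef A S where
  incl : A →+* T
  incl_cocartesian :
    IsCocartesianSquare (algebraMap k S.carrier) (algebraMap k A) (algebraMap S.carrier T) incl
  proj_incl : ∀ a, algebraMap T A (incl a) = a

variable {A} {N M : Type u} [AddCommGroup N] [Module A N] [AddCommGroup M] [Module A M]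

/-- Deformations of the `A`-module `N` to `S`, where `A` deforms trivially. -/
structure TrivPairDef (N : Type u) [AddCommGroup N] [Module A N] (S : Base k k) where
  alg : TrivAlgDef A S
  mod : ModDef alg.toAlgDef N

instance TrivPairDef.setoid (S : Base k k) : Setoid (TrivPairDef (A := A) N S) where
  r ξ ξ' := ∃ e : ξ.alg.T ≃+* ξ'.alg.T,
    (∀ a, e (ξ.alg.incl a) = ξ'.alg.incl a) ∧ IsIsoOver e ξ.mod ξ'.mod
  iseqv := by
    refine ⟨fun ξ => ⟨_, fun _ => rfl, IsIsoOver.refl ξ.mod⟩, ?_, ?_⟩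
    · rintro _ _ ⟨e, he, h⟩
      exact ⟨e.symm, fun a => by rw [← he a, e.symm_apply_apply], h.symm⟩
    · rintro _ _ _ ⟨e, he, h⟩ ⟨e', he', h'⟩
      exact ⟨e.trans e', fun a => by rw [RingEquiv.trans_apply, he, he'], h.trans h'⟩

/-- The set `Def^A_N(S)` of isomorphism classes of deformations of the `A`-module `N` to `S`. -/
def DefMod (A : Type u) [CommRing A] [Algebra k A] (N : Type u) [AddCommGroup N] [Module A N]
    (S : Base k k) : Type (u + 1) :=
  Quotient (TrivPairDef.setoid (A := A) (N := N) S)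

/-- The class of a deformation. -/
def DefMod.mk {S : Base k k} (ξ : TrivPairDef (A := A) N S) : DefMod A N S :=
  Quotient.mk _ ξ

/-- The (graph of the) map `Def^A_N(S) → Def^A_N(S₀)` induced by `f : S → S₀`: it sends
the class of `ξ` to the class of the target of a cocartesian map from `ξ` lying over `f`. -/
def DefMod.Maps {S S₀ : Base k k} (f : BaseHom S S₀) (a : DefMod A N S)
    (a₀ : DefMod A N S₀) : Prop :=
  ∃ (ξ : TrivPairDef (A := A) N S) (ξ₀ : TrivPairDef (A := A) N S₀),
    DefMod.mk ξ = a ∧ DefMod.mk ξ₀ = a₀ ∧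
      ∃ φ : ξ.alg.T →+* ξ₀.alg.T,
        (∀ c, φ (ξ.alg.incl c) = ξ₀.alg.incl c) ∧ IsMapOver f φ ξ.mod ξ₀.mod

/-- The maps `σ_M^A : Def^A_N(S) → Def^A_M(S)` induced by the minimal MCM approximation
`p : M → N`. -/
def IsInducedMod [IsLocalRing A] (p : M →ₗ[A] N)
    (σ : ∀ S : Base k k, DefMod A N S → DefMod A M S) : Prop :=
  ∀ (S : Base k k) (t : TrivAlgDef A S) (x : ModDef t.toAlgDef N),
    (∃ (y : ModDef t.toAlgDef M) (π : y.X →ₗ[t.T] x.X), IsApproxMap p x y π) ∧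
    ∀ (y : ModDef t.toAlgDef M) (π : y.X →ₗ[t.T] x.X), IsApproxMap p x y π →
      σ S (DefMod.mk ⟨t, x⟩) = DefMod.mk ⟨t, y⟩

end Trivial

/-! ### Maps of functors and smoothness -/

section Smooth

variable {O : Type v} [CommRing O] {k : Type u} [Field k] [Algebra O k]
variable {F G : Base O k → Type w}

/-- `σ : F → G` is a map of functors, where the maps `F(f)` and `G(f)` are given by their
graphs. -/
def IsNatural (mapF : ∀ {S S₀ : Base O k}, BaseHom S S₀ → F S → F S₀ → Prop)
    (mapG : ∀ {S S₀ : Base O k}, BaseHom S S₀ → G S → G S₀ → Prop)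
    (σ : ∀ S, F S → G S) : Prop :=
  ∀ (S S₀ : Base O k) (f : BaseHom S S₀) (a : F S) (a₀ : F S₀),
    mapF f a a₀ → mapG f (σ S a) (σ S₀ a₀)

/-- `σ : F → G` is smooth: `F(S) → F(S₀) ×_{G(S₀)} G(S)` is surjective for every surjection
`S → S₀`. -/
def IsSmooth (mapF : ∀ {S S₀ : Base O k}, BaseHom S S₀ → F S → F S₀ → Prop)
    (mapG : ∀ {S S₀ : Base O k}, BaseHom S S₀ → G S → G S₀ → Prop)
    (σ : ∀ S, F S → G S) : Prop :=
  ∀ (S S₀ : Base O k) (f : BaseHom S S₀), Function.Surjective f.hom →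
    ∀ (a₀ : F S₀) (b : G S), mapG f b (σ S₀ a₀) → ∃ a : F S, mapF f a a₀ ∧ σ S a = b

end Smooth

end CMDef

/-!
The hypothesis on the depth enters only through the kernel `L` of `p : M → N`. Over `A`, modules `Z`
of finite injective dimension satisfy `Ext^i(X, Z) = 0` for `i > dim A - depth X`
(`subsingleton_ext_of_depth`). Hence `Ext^1(M, Z) = 0` and, as `depth N = dim A - 1`,
`Ext^2(N, Z) = 0`, so that `Ext^1(L, Z) = 0`. Applied to the first syzygy of `L`, which has finite
injective dimension as `A` is Gorenstein, this shows that `L` is free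
(`IsMinimalMCMApprox.free_ker`).

Since base change along a surjection of henselian local rings is reduction modulo the kernel
(`IsCocartesianSquare.surjective_and_ker_eq`), a deformation `S → T` of `A` satisfies
`A = T / 𝔪_S T`, and a deformation `X` of `N` is a flat module with `N = X / 𝔪_S X`. No more of
henselisation and of algebraic maps is needed: the algebra `T` never changes. Two tools relate
`T`-modules to their closed fibres.

* The local criterion of flatness `flat_quotient_range_of_fibre`: the cokernel of a map of
  `T`-modules which is injective on closed fibres is flat if its target is.
* The lifting theorem `exists_lift`: maps of flat modules into the target of a surjection
  `π₀ : Y₀ → X₀` lift to `Y₀`, with prescribed closed fibre, if `Ext^1_A` from the closed fibre of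
  the source to that of `ker π₀` vanishes. The obstruction is a map from a syzygy to
  `𝔪_S₀ ker π₀`, and the vanishing of `Ext^1_A` passes to `ker π₀ ⊗ Q` for all finite `S₀`-modules
  `Q` by dévissage and Nakayama's lemma (`extendsAlong_tensorProduct`).

A surjection from a deformation of `M` to one of `N` over `p` is automatically a minimal MCM
approximation (`IsApproxMap.of_surjective`). It exists: with `0 → K → T^r → X → 0`, the map from the
closed fibre of `K` to `L` lifts to a map from `K` to a free module, since the obstruction group is
`Ext^2(N, L) = 0`, and the pushout is the required module (`exists_flat_approx`). As
`Ext^1(M, L) = 0`, maps of deformations of `N` extend to the approximations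
(`IsApproxMap.exists_map`), which makes `σ_M` well defined and natural. Finally let `Y` be a
deformation of `M` whose base change `Y₀` to `S₀` approximates a deformation `X₀` of `N`. A basis of
`L` lifts to `ker (Y₀ → X₀)`, then to `Y`, and the cokernel of the resulting map from a free module
to `Y` is a deformation of `N` which is approximated by `Y` and has base change `X₀`
(`exists_isApproxMap_of_isMapOver`). This is smoothness.
-/

namespace CMDef

/-! ### Vanishing of `Ext` into modules of finite injective dimension -/

open IsLocalRing Abelian RingTheory.Sequence

section ExtVanishing

variable {A : Type u} [CommRing A]

theorem isSMulRegular_of_equiv_quotient_prime {X : Type*} [AddCommGroup X] [Module A X]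
    {p : Ideal A} (f : X ≃ₗ[A] A ⧸ p) (hp : p.IsPrime) {x : A} (hx : x ∉ p) :
    IsSMulRegular X x := (f.isSMulRegular_congr x).mpr fun a b hab => by
  have := sub_eq_zero.mpr hab
  simp only [← smul_sub] at this
  obtain ⟨c, hc⟩ := Ideal.Quotient.mk_surjective (a - b)
  rw [← hc, ← Ideal.Quotient.mk_eq_mk, ← Submodule.Quotient.mk_smul,
    Ideal.Quotient.mk_eq_mk, Ideal.Quotient.eq_zero_iff_mem, smul_eq_mul] at this
  rw [← sub_eq_zero, ← hc, Ideal.Quotient.eq_zero_iff_mem]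
  exact (hp.mem_or_mem this).resolve_left hx

theorem subsingleton_ext_X₁ {S : ShortComplex (ModuleCat.{u} A)} (hS : S.ShortExact)
    (Z : ModuleCat.{u} A) (i : ℕ) (h₂ : Subsingleton (Ext S.X₂ Z i))
    (h₃ : Subsingleton (Ext S.X₃ Z (i + 1))) : Subsingleton (Ext S.X₁ Z i) := by
  refine subsingleton_of_forall_eq 0 fun x => ?_
  obtain ⟨y, rfl⟩ := Ext.contravariant_sequence_exact₁ hS Z x (add_comm 1 i) (Subsingleton.elim _ _)
  rw [Subsingleton.elim y 0, Ext.comp_zero]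

theorem subsingleton_ext_X₂ {S : ShortComplex (ModuleCat.{u} A)} (hS : S.ShortExact)
    (Z : ModuleCat.{u} A) (i : ℕ) (h₁ : Subsingleton (Ext S.X₁ Z i))
    (h₃ : Subsingleton (Ext S.X₃ Z i)) : Subsingleton (Ext S.X₂ Z i) := by
  refine subsingleton_of_forall_eq 0 fun x => ?_
  obtain ⟨y, rfl⟩ := Ext.contravariant_sequence_exact₂ hS Z x (Subsingleton.elim _ _)
  rw [Subsingleton.elim y 0, Ext.comp_zero]

theorem subsingleton_ext_of_iso {X Y : ModuleCat.{u} A} (e : X ≅ Y) (Z : ModuleCat.{u} A) (i : ℕ)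
    (h : Subsingleton (Ext Y Z i)) : Subsingleton (Ext X Z i) := by
  refine subsingleton_of_forall_eq 0 fun x => ?_
  rw [← Ext.mk₀_id_comp x, ← e.hom_inv_id, ← Ext.mk₀_comp_mk₀_assoc,
    Subsingleton.elim ((Ext.mk₀ e.inv).comp x (zero_add i)) 0, Ext.comp_zero]

/-- A map from a submodule `ker q` of a free module, with `q` onto `X`, extends to the free module
if its target `Z` has `Ext^1(X, Z) = 0`. -/
theorem exists_extension_of_subsingleton_ext_one {F X Z : Type u} [AddCommGroup F] [Module A F]
    [AddCommGroup X] [Module A X] [AddCommGroup Z] [Module A Z] (q : F →ₗ[A] X)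
    (hq : Function.Surjective q)
    (h : Subsingleton (Ext (ModuleCat.of A X) (ModuleCat.of A Z) 1))
    (g : LinearMap.ker q →ₗ[A] Z) : ∃ g' : F →ₗ[A] Z, ∀ x : LinearMap.ker q, g' x = g x := by
  have hS := LinearMap.shortExact_shortComplexKer hq
  obtain ⟨y, hy⟩ := Ext.contravariant_sequence_exact₁ hS (ModuleCat.of A Z)
    (Ext.mk₀ (ModuleCat.ofHom g)) (add_zero 1) (@Subsingleton.elim _ h _ _)
  obtain ⟨y, rfl⟩ := (Ext.mk₀_bijective _ _).2 y
  rw [Ext.mk₀_comp_mk₀] at hy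
  have := (Ext.mk₀_bijective _ _).1 hy
  exact ⟨y.hom, fun x => congrArg (fun f => f.hom x) this⟩

/-- Over a Gorenstein local ring, finite free modules have finite injective dimension. -/
theorem IsFID.pi_fin (h : IsFID A A) (r : ℕ) : IsFID A (Fin r → A) := by
  obtain ⟨-, n, hn⟩ := h
  refine ⟨inferInstance, n, ?_⟩
  induction r with
  | zero =>
    have := (ModuleCat.isZero_of_subsingleton
      (ModuleCat.of A (Fin 0 → A))).hasInjectiveDimensionLT_zero
    exact hasInjectiveDimensionLT_of_ge _ 0 (n + 1) (Nat.zero_le _)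
  | succ r ih =>
    have e : (A × (Fin r → A)) ≃ₗ[A] (Fin (r + 1) → A) := Fin.consLinearEquiv A fun _ => A
    exact hasInjectiveDimensionLT_of_iso
      (ModuleCat.biprodIsoProd (ModuleCat.of A A) (ModuleCat.of A (Fin r → A)) ≪≫ e.toModuleIso) _

variable [IsLocalRing A]

theorem exists_isWeaklyRegular_of_le_depth {X : Type u} [AddCommGroup X] [Module A X] {r : ℕ}
    (h : (r : ℕ∞) ≤ depth A X) : ∃ rs : List A, (∀ x ∈ rs, x ∈ maximalIdeal A) ∧
      IsWeaklyRegular X rs ∧ r ≤ rs.length := by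
  rcases r with _ | r
  · exact ⟨[], by simp, .nil A X, le_rfl⟩
  · have hlt : (r : ℕ∞) < depth A X := lt_of_lt_of_le (by norm_cast; omega) h
    rw [depth, lt_iSup_iff] at hlt
    obtain ⟨rs, hrs⟩ := hlt
    rw [lt_iSup_iff] at hrs
    obtain ⟨⟨h₁, h₂⟩, h₃⟩ := hrs
    exact ⟨rs, h₁, h₂, by exact_mod_cast h₃⟩

variable [IsNoetherianRing A]

/-- Nakayama's lemma for `Ext`: multiplication by a regular element `x` of the maximal ideal is
surjective on `Ext^i(X, Z)` once `Ext^{i+1}(X / x X, Z)` vanishes. -/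
theorem subsingleton_ext_of_quotSMulTop (X Z : ModuleCat.{u} A) [Module.Finite A X]
    [Module.Finite A Z] {x : A} (hx : x ∈ maximalIdeal A) (hreg : IsSMulRegular X x) (i : ℕ)
    (h : Subsingleton (Ext (ModuleCat.of A (QuotSMulTop x X)) Z (i + 1))) :
    Subsingleton (Ext X Z i) := by
  have hsurj : ∀ y : Ext X Z i, ∃ z : Ext X Z i, x • z = y := fun y => by
    obtain ⟨z, hz⟩ : ∃ z : Ext X Z i, (Ext.mk₀ (x • 𝟙 X)).comp z (zero_add i) = y :=
      Ext.contravariant_sequence_exact₁ hreg.smulShortComplex_shortExact Z y (add_comm 1 i)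
        (@Subsingleton.elim _ h _ _)
    exact ⟨z, by rw [← hz, Ext.mk₀_smul, Ext.smul_comp, Ext.mk₀_id_comp]⟩
  have hbot : (⊤ : Submodule A (Ext X Z i)) = ⊥ := by
    refine Submodule.eq_bot_of_le_smul_of_le_jacobson_bot (maximalIdeal A) _
      (Module.finite_def.mp inferInstance) (fun y _ => ?_) (maximalIdeal_le_jacobson _)
    obtain ⟨z, rfl⟩ := hsurj y
    exact Submodule.smul_mem_smul hx trivial
  exact (Submodule.subsingleton_iff A).mp (subsingleton_of_bot_eq_top hbot.symm)

theorem ringKrullDim_eq_natCast :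
    ∃ d : ℕ, ringKrullDim A = ((d : ℕ∞) : WithBot ℕ∞) := by
  obtain ⟨e, he⟩ := WithBot.ne_bot_iff_exists.mp (ringKrullDim_ne_bot (R := A))
  have he' : e ≠ ⊤ := fun h => ringKrullDim_ne_top (R := A) (by rw [← he, h]; rfl)
  exact ⟨e.toNat, by rw [ENat.natCast_toNat he', he]⟩

/-- There is an `A`-regular sequence `rs`, of length at most `dim A`, such that the residue field
embeds in `A / (rs)`. -/
theorem exists_isRegular_injective_residue : ∃ rs : List A, IsRegular A rs ∧
    ((rs.length : ℕ∞) : WithBot ℕ∞) ≤ ringKrullDim A ∧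
    ∃ f : (A ⧸ maximalIdeal A) →ₗ[A] (A ⧸ Ideal.ofList rs), Function.Injective f := by
  classical
  have hle : ∀ rs : List A, IsRegular A rs →
      ((rs.length : ℕ∞) : WithBot ℕ∞) ≤ ringKrullDim A := fun rs hrs => by
    have hnt : Nontrivial (A ⧸ Ideal.ofList rs) := by
      refine Ideal.Quotient.nontrivial_iff.mpr fun h => hrs.top_ne_smul ?_
      rw [h]; simp
    rw [← ringKrullDim_add_length_eq_ringKrullDim_of_isRegular rs hrs]
    have h0 : 0 ≤ ringKrullDim (A ⧸ Ideal.ofList rs) := ringKrullDim_nonneg_of_nontrivial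
    simpa using add_le_add_left h0 ((rs.length : ℕ∞) : WithBot ℕ∞)
  obtain ⟨d, hd⟩ := ringKrullDim_eq_natCast (A := A)
  by_contra hno
  -- otherwise every regular sequence could be prolonged, beyond the length `dim A`
  have hall : ∀ n : ℕ, ∃ rs : List A, rs.length = n ∧ (∀ r ∈ rs, r ∈ maximalIdeal A) ∧
      IsRegular A rs := fun n => by
    induction n with
    | zero => exact ⟨[], rfl, by simp, .nil A A⟩
    | succ n ih =>
      obtain ⟨rs, hlen, hmem, hreg⟩ := ih
      have hss : Subsingleton ((A ⧸ maximalIdeal A) →ₗ[A] (A ⧸ Ideal.ofList rs)) := by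
        refine subsingleton_of_forall_eq 0 fun f => ?_
        by_contra hf
        have : IsSimpleModule A (A ⧸ maximalIdeal A) := isSimpleModule_iff_isCoatom.mpr
          (Ideal.IsMaximal.out : IsCoatom (maximalIdeal A))
        exact hno ⟨rs, hreg, hle rs hreg, f, (LinearMap.injective_or_eq_zero f).resolve_right hf⟩
      obtain ⟨r, hr, hrreg⟩ := IsSMulRegular.subsingleton_linearMap_iff.mp hss
      rw [Ideal.annihilator_quotient] at hr
      have hmem' : ∀ x ∈ rs ++ [r], x ∈ maximalIdeal A := by
        intro x hx
        rcases List.mem_append.mp hx with h | h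
        · exact hmem x h
        · rw [List.mem_singleton.mp h]; exact hr
      refine ⟨rs ++ [r], by simp [hlen], hmem', .of_isWeaklyRegular_of_mem_maximalIdeal A hmem' ?_⟩
      rw [isWeaklyRegular_append_iff, isWeaklyRegular_singleton_iff]
      refine ⟨hreg.1, ?_⟩
      rwa [smul_eq_mul, Ideal.mul_top]
  obtain ⟨rs, hlen, -, hreg⟩ := hall (d + 1)
  have := hle rs hreg
  rw [hlen, hd] at this
  norm_cast at this
  omega

/-- Bass: if the finite module `Z` has finite injective dimension, then this dimension is at most
`dim A`. -/
theorem subsingleton_ext_of_ringKrullDim_lt (Z : ModuleCat.{u} A) [Module.Finite A Z] {n : ℕ}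
    (hZ : HasInjectiveDimensionLE Z n) (X : ModuleCat.{u} A) [Module.Finite A X] (i : ℕ)
    (hi : ringKrullDim A < ((i : ℕ∞) : WithBot ℕ∞)) : Subsingleton (Ext X Z i) := by
  -- descending induction on the bound for the nonvanishing `Ext`-modules of finite modules
  suffices H : ∀ e m : ℕ, n + 1 ≤ m + e → ringKrullDim A < ((m : ℕ∞) : WithBot ℕ∞) →
      ∀ (X : Type u) [AddCommGroup X] [Module A X] [Module.Finite A X],
        Subsingleton (Ext (ModuleCat.of A X) Z m) from
    H (n + 1) i (by omega) hi X
  intro e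
  induction e with
  | zero =>
    intro m hm _ X _ _ _
    exact HasInjectiveDimensionLT.subsingleton Z (n + 1) m (by omega) _
  | succ e ih =>
    intro m hm hdim X _ _ _
    have hnext : ∀ (X : Type u) [AddCommGroup X] [Module A X] [Module.Finite A X],
        Subsingleton (Ext (ModuleCat.of A X) Z (m + 1)) := by
      refine ih (m + 1) (by omega) (hdim.trans ?_)
      norm_cast
      omega
    -- the residue field embeds in a module of projective dimension less than `m`
    have hres : Subsingleton (Ext (ModuleCat.of A (A ⧸ maximalIdeal A)) Z m) := by
      obtain ⟨rs, hreg, hlen, f, hf⟩ := exists_isRegular_injective_residue (A := A)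
      have hpd := ModuleCat.projectiveDimension_quotient_eq_length.{u} rs hreg
      have hlt : projectiveDimension
          (ModuleCat.of A (Shrink.{u} (A ⧸ Ideal.ofList rs))) < (m : WithBot ℕ∞) := by
        rw [hpd]
        exact lt_of_le_of_lt hlen hdim
      have hpd' : HasProjectiveDimensionLT (ModuleCat.of A (A ⧸ Ideal.ofList rs)) m :=
        @hasProjectiveDimensionLT_of_iso _ _ _ _ _
          (Shrink.linearEquiv A (A ⧸ Ideal.ofList rs)).toModuleIso _
          (projectiveDimension_lt_iff.mp hlt)
      have hS := ModuleCat.shortComplex_shortExact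
        (ModuleCat.shortComplexOfCompEqZero f (LinearMap.range f).mkQ
          f.exact_map_mkQ_range.linearMap_comp_eq_zero)
        f.exact_map_mkQ_range hf (Submodule.mkQ_surjective _)
      exact subsingleton_ext_X₁ hS Z m
        (HasProjectiveDimensionLT.subsingleton _ m m le_rfl Z) (hnext _)
    induction ‹Module.Finite A X› using
      IsNoetherianRing.induction_on_isQuotientEquivQuotientPrime A with
    | subsingleton N =>
      have := (ModuleCat.isZero_of_subsingleton
        (ModuleCat.of A N)).hasProjectiveDimensionLT_zero
      exact HasProjectiveDimensionLT.subsingleton _ 0 m (Nat.zero_le m) Z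
    | quotient N p f =>
      by_cases hp : p.1 = maximalIdeal A
      · exact subsingleton_ext_of_iso
          (f.trans (Submodule.quotEquivOfEq _ _ hp)).toModuleIso Z m hres
      · obtain ⟨x, hx, hxp⟩ := Set.exists_of_ssubset ((le_maximalIdeal p.2.ne_top).lt_of_ne hp)
        have hreg := isSMulRegular_of_equiv_quotient_prime f p.2 hxp
        exact subsingleton_ext_of_quotSMulTop (ModuleCat.of A N) Z hx hreg m (hnext _)
    | exact N₁ N₂ N₃ f g hf hg hfg h₁ h₃ =>
      exact subsingleton_ext_X₂ (ModuleCat.shortComplex_shortExact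
        (ModuleCat.shortComplexOfCompEqZero f g hfg.linearMap_comp_eq_zero) hfg hf hg) Z m h₁ h₃

/-- If a finite module `Z` has finite injective dimension and the finite module `X` has a weakly
regular sequence of length `r` in the maximal ideal, then `Ext^i(X, Z) = 0` for `i > dim A - r`. -/
theorem subsingleton_ext_of_isWeaklyRegular (Z : ModuleCat.{u} A) [Module.Finite A Z] {n : ℕ}
    (hZ : HasInjectiveDimensionLE Z n) (rs : List A) :
    ∀ (X : Type u) [AddCommGroup X] [Module A X] [Module.Finite A X],
      (∀ r ∈ rs, r ∈ maximalIdeal A) → IsWeaklyRegular X rs → ∀ i : ℕ,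
      ringKrullDim A < (((i + rs.length : ℕ) : ℕ∞) : WithBot ℕ∞) →
      Subsingleton (Ext (ModuleCat.of A X) Z i) := by
  induction rs with
  | nil => exact fun X _ _ _ _ _ i hi => subsingleton_ext_of_ringKrullDim_lt Z hZ _ i hi
  | cons x rs ih =>
    intro X _ _ _ hmem hreg i hi
    rw [isWeaklyRegular_cons_iff] at hreg
    simp only [List.mem_cons, forall_eq_or_imp] at hmem
    refine subsingleton_ext_of_quotSMulTop (ModuleCat.of A X) Z hmem.1 hreg.1 i
      (ih (QuotSMulTop x X) hmem.2 hreg.2 (i + 1) ?_)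
    rwa [List.length_cons, add_comm rs.length 1, ← add_assoc] at hi

/-- Ischebeck's vanishing: `Ext^i(X, Z) = 0` for `i > dim A - depth X`, if `Z` has finite injective
dimension. -/
theorem subsingleton_ext_of_depth {X Z : Type u} [AddCommGroup X] [Module A X] [Module.Finite A X]
    [AddCommGroup Z] [Module A Z] (hZ : IsFID A Z) {d r i : ℕ}
    (hd : ringKrullDim A = ((d : ℕ∞) : WithBot ℕ∞)) (hr : (r : ℕ∞) ≤ depth A X) (hi : d < i + r) :
    Subsingleton (Ext (ModuleCat.of A X) (ModuleCat.of A Z) i) := by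
  obtain ⟨hfin, n, hn⟩ := hZ
  obtain ⟨rs, h₁, h₂, h₃⟩ := exists_isWeaklyRegular_of_le_depth hr
  refine subsingleton_ext_of_isWeaklyRegular (ModuleCat.of A Z) hn rs X h₁ h₂ i ?_
  rw [hd]
  norm_cast
  omega

/-- A finite module `L` of finite injective dimension over a Gorenstein local ring is free as soon
as `Ext^1(L, Z) = 0` for all finite modules `Z` of finite injective dimension: the first syzygy of
`L` is such a `Z`. -/
theorem IsFID.free {L : Type u} [AddCommGroup L] [Module A L] (hL : IsFID A L) (hA : IsFID A A)
    (h : ∀ (Z : Type u) [AddCommGroup Z] [Module A Z], IsFID A Z →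
      Subsingleton (Ext (ModuleCat.of A L) (ModuleCat.of A Z) 1)) : Module.Free A L := by
  obtain ⟨hfin, n, hn⟩ := hL
  obtain ⟨r, f, hf⟩ := Module.Finite.exists_fin' A L
  obtain ⟨-, m, hm⟩ := hA.pi_fin r
  have hS := LinearMap.shortExact_shortComplexKer hf
  have hker : IsFID A (LinearMap.ker f) := by
    refine ⟨inferInstance, n + m + 1, ?_⟩
    refine hS.hasInjectiveDimensionLT_X₁ (n + m + 1) ?_ ?_
    · exact hasInjectiveDimensionLT_of_ge _ (n + 1) _ (by omega)
    · exact hasInjectiveDimensionLT_of_ge _ (m + 1) _ (by omega)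
  have hss := h _ hker
  obtain ⟨s, hs⟩ := Ext.covariant_sequence_exact₃ (ModuleCat.of A L) hS
    (Ext.mk₀ (𝟙 (ModuleCat.of A L))) (zero_add 1) (@Subsingleton.elim _ hss _ _)
  obtain ⟨s, rfl⟩ := (Ext.mk₀_bijective _ _).2 s
  rw [Ext.mk₀_comp_mk₀] at hs
  have hs' := (Ext.mk₀_bijective _ _).1 hs
  have : Module.Projective A L := .of_split s.hom f
    (LinearMap.ext fun x => congrArg (fun g => g.hom x) hs')
  exact Module.free_of_flat_of_isLocalRing

end ExtVanishing

/-! ### The approximation over the closed fibre -/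

section ClosedFibre

variable {A : Type u} [CommRing A] [IsLocalRing A] {N M : Type u} [AddCommGroup N] [Module A N]
  [Module.Finite A N] [AddCommGroup M] [Module A M]

theorem IsMCM.subsingleton_ext [IsNoetherianRing A] (hM : IsMCM A M) {Z : Type u} [AddCommGroup Z]
    [Module A Z] (hZ : IsFID A Z) {i : ℕ} (hi : 1 ≤ i) :
    Subsingleton (Ext (ModuleCat.of A M) (ModuleCat.of A Z) i) := by
  obtain ⟨d, hd⟩ := ringKrullDim_eq_natCast (A := A)
  obtain ⟨hfin, hdep⟩ := hM
  rw [hd] at hdep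
  exact subsingleton_ext_of_depth hZ hd (WithBot.coe_le_coe.mp hdep) (by omega)

theorem subsingleton_ext_of_depth_add_one [IsNoetherianRing A]
    (hdepth : ((depth A N : ℕ∞) : WithBot ℕ∞) + 1 = ringKrullDim A)
    {Z : Type u} [AddCommGroup Z] [Module A Z] (hZ : IsFID A Z) {i : ℕ} (hi : 2 ≤ i) :
    Subsingleton (Ext (ModuleCat.of A N) (ModuleCat.of A Z) i) := by
  obtain ⟨d, hd⟩ := ringKrullDim_eq_natCast (A := A)
  rw [hd] at hdepth
  have h : depth A N + 1 = d := by exact_mod_cast hdepth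
  refine subsingleton_ext_of_depth (r := d - 1) hZ hd ?_ (by omega)
  have hne : depth A N ≠ ⊤ := fun h' => by simp [h'] at h
  obtain ⟨e, he⟩ := ENat.ne_top_iff_exists.mp hne
  rw [← he] at h ⊢
  norm_cast at h ⊢
  omega

/-- If `depth N = dim A - 1`, then the kernel of a minimal MCM approximation of `N` is free. -/
theorem IsMinimalMCMApprox.free_ker {p : M →ₗ[A] N} (hp : IsMinimalMCMApprox p)
    (hGor : IsGorensteinLocal A)
    (hdepth : ((depth A N : ℕ∞) : WithBot ℕ∞) + 1 = ringKrullDim A) :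
    Module.Free A (LinearMap.ker p) := by
  have := hGor.2.1
  refine hp.fid.free ⟨inferInstance, hGor.2.2⟩ fun Z _ _ hZ => ?_
  exact subsingleton_ext_X₁ (LinearMap.shortExact_shortComplexKer hp.surjective)
    (ModuleCat.of A Z) 1 (hp.mcm.subsingleton_ext hZ le_rfl)
    (subsingleton_ext_of_depth_add_one hdepth hZ le_rfl)

end ClosedFibre
end CMDef

namespace CMDef

/-! ### Flatness over a noetherian local ring -/

open IsLocalRing
open scoped Pointwise

section Flatness

variable {S : Type u} [CommRing S]

/-- If `X = F / K` is flat, then `K ∩ I F = I K`. -/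
theorem mem_smul_ker_of_flat {F X : Type*} [AddCommGroup F] [Module S F] [AddCommGroup X]
    [Module S X] [Module.Flat S X] (q : F →ₗ[S] X) (hq : Function.Surjective q) (I : Ideal S)
    {x : F} (hx : x ∈ I • (⊤ : Submodule S F)) (hqx : q x = 0) : x ∈ I • LinearMap.ker q := by
  have htop : (⊤ : Submodule S F) = Submodule.span S (Set.range (id : F → F)) := by simp
  rw [htop, Submodule.mem_ideal_smul_span_iff_exists_sum] at hx
  obtain ⟨a, ha, rfl⟩ := hx
  rw [Finsupp.sum, ← Finset.sum_coe_sort] at hqx ⊢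
  simp only [map_sum, map_smul, id] at hqx ⊢
  obtain ⟨n, b, y, hy, hb⟩ := Module.Flat.isTrivialRelation_of_sum_smul_eq_zero hqx
  choose z hz using fun j => hq (y j)
  have hsum : ∑ i : a.support, a i • (i : F) =
      ∑ i : a.support, a i • ((i : F) - ∑ j, b i j • z j) := by
    simp only [smul_sub, Finset.sum_sub_distrib, Finset.smul_sum, smul_smul]
    rw [Finset.sum_comm]
    simp only [← Finset.sum_smul, hb, zero_smul, Finset.sum_const_zero, sub_zero]
  rw [hsum]
  refine Submodule.sum_mem _ fun i _ => Submodule.smul_mem_smul (ha i) ?_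
  simp [hy, hz]

/-- The kernel of a surjection between flat modules is flat. -/
theorem flat_ker {Y X : Type*} [AddCommGroup Y] [Module S Y] [AddCommGroup X] [Module S X]
    [Module.Flat S Y] [Module.Flat S X] (q : Y →ₗ[S] X) (hq : Function.Surjective q) :
    Module.Flat S (LinearMap.ker q) := by
  refine Module.Flat.iff_rTensor_injective'.mpr fun I => ?_
  have h₁ := LinearMap.lTensor_injective_of_exact_of_flat q hq (LinearMap.ker q).subtype
    (LinearMap.ker q).subtype_injective (LinearMap.exact_subtype_ker_map q) I
  have h₂ := Module.Flat.rTensor_preserves_injective_linearMap (M := Y) I.subtype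
    I.subtype_injective
  have h₃ : Function.Injective (((LinearMap.ker q).subtype.lTensor S) ∘ₗ
      (I.subtype.rTensor (LinearMap.ker q))) := by
    rw [LinearMap.lTensor_comp_rTensor, ← LinearMap.rTensor_comp_lTensor]
    exact h₂.comp h₁
  exact Function.Injective.of_comp h₃

/-- For a cyclic module `Q ≅ S / I`, the map `X → X ⊗ Q` given by the generator of `Q` is onto
with kernel `I X`. -/
theorem tmul_generator {I : Ideal S} {Q : Type*} [AddCommGroup Q] [Module S Q]
    (e : Q ≃ₗ[S] S ⧸ I) (X : Type*) [AddCommGroup X] [Module S X] :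
    (∀ z : X ⊗[S] Q, ∃ x : X, x ⊗ₜ[S] e.symm 1 = z) ∧
      ∀ x : X, x ⊗ₜ[S] e.symm 1 = 0 ↔ x ∈ I • (⊤ : Submodule S X) := by
  let θ : X ⊗[S] Q ≃ₗ[S] X ⧸ (I • (⊤ : Submodule S X)) :=
    (TensorProduct.congr (LinearEquiv.refl S X) e).trans (tensorQuotEquivQuotSMul X I)
  have hθ : ∀ x : X, θ (x ⊗ₜ e.symm 1) = Submodule.Quotient.mk x := fun x => by
    have : (1 : S ⧸ I) = Ideal.Quotient.mk I 1 := rfl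
    simp only [θ, LinearEquiv.trans_apply, congr_tmul, LinearEquiv.refl_apply,
      LinearEquiv.apply_symm_apply, this]
    rw [tensorQuotEquivQuotSMul_tmul_mk, one_smul]
  refine ⟨fun z => ?_, fun x => ?_⟩
  · obtain ⟨x, hx⟩ := Submodule.Quotient.mk_surjective _ (θ z)
    exact ⟨x, θ.injective ((hθ x).trans hx)⟩
  · rw [← Submodule.Quotient.mk_eq_zero, ← hθ, θ.map_eq_zero_iff]

section LocalCriterion

variable {T : Type u} [CommRing T] [Algebra S T] {P Y : Type u}
  [AddCommGroup P] [Module S P] [Module T P] [IsScalarTower S T P]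
  [AddCommGroup Y] [Module S Y] [Module T Y] [IsScalarTower S T Y]

theorem finite_tensorProduct_left [Module.Finite T P] (Q : Type*) [AddCommGroup Q] [Module S Q]
    [Module.Finite S Q] : Module.Finite T (P ⊗[S] Q) := by
  obtain ⟨n, f, hf⟩ := Module.Finite.exists_fin' S Q
  have e : P ⊗[S] (Fin n → S) ≃ₗ[T] (Fin n → P) := TensorProduct.piScalarRight S T P (Fin n)
  have : Module.Finite T (P ⊗[S] (Fin n → S)) := .equiv e.symm
  exact .of_surjective (AlgebraTensorModule.lTensor T P f) (LinearMap.lTensor_surjective P hf)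

theorem lTensor_lsmul (Q : Type*) [AddCommGroup Q] [Module S Q] (s : S) (z : Y ⊗[S] Q) :
    (LinearMap.lsmul S Q s).lTensor Y z = s • z := by
  induction z with
  | zero => simp
  | tmul y q => simp
  | add a b ha hb => rw [map_add, ha, hb, smul_add]

theorem isSMulRegular_tensorProduct [Module.Flat S Y] {Q : Type*} [AddCommGroup Q] [Module S Q]
    {s : S} (hs : IsSMulRegular Q s) : IsSMulRegular (Y ⊗[S] Q) s := by
  have := Module.Flat.lTensor_preserves_injective_linearMap (M := Y) (LinearMap.lsmul S Q s) hs
  intro a b hab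
  apply this
  rw [lTensor_lsmul, lTensor_lsmul]
  exact hab

theorem exact_lsmul_mkQ (Q : Type*) [AddCommGroup Q] [Module S Q] (s : S) :
    Function.Exact (LinearMap.lsmul S Q s) (Submodule.mkQ (s • (⊤ : Submodule S Q))) := fun x => by
  rw [Submodule.mkQ_apply, Submodule.Quotient.mk_eq_zero, Submodule.mem_smul_pointwise_iff_exists]
  simp

theorem exists_smul_eq_of_lTensor_mkQ_eq_zero {Q : Type*} [AddCommGroup Q] [Module S Q] {s : S}
    {z : Y ⊗[S] Q} (hz : (Submodule.mkQ (s • (⊤ : Submodule S Q))).lTensor Y z = 0) :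
    ∃ z', s • z' = z := by
  obtain ⟨z', rfl⟩ := (lTensor_exact Y (exact_lsmul_mkQ Q s) (Submodule.mkQ_surjective _) z).mp hz
  exact ⟨z', (lTensor_lsmul Q s z').symm⟩

variable [IsLocalRing S] [IsNoetherianRing S]

/-- Dévissage: a property of finite modules over a noetherian local ring holds for all of them if
it holds for the residue field, is stable under extensions, and holds for `Q` whenever it holds for
`Q / s Q` with a `Q`-regular element `s` of the maximal ideal. -/
theorem finite_module_devissage {motive : (Q : Type u) → [AddCommGroup Q] → [Module S Q] → Prop}
    (subsingleton : ∀ (Q : Type u) [AddCommGroup Q] [Module S Q], Subsingleton Q → motive Q)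
    (residue : ∀ (Q : Type u) [AddCommGroup Q] [Module S Q], (Q ≃ₗ[S] S ⧸ maximalIdeal S) →
      motive Q)
    (regular : ∀ (Q : Type u) [AddCommGroup Q] [Module S Q] [Module.Finite S Q],
      ∀ s ∈ maximalIdeal S, IsSMulRegular Q s → motive (QuotSMulTop s Q) → motive Q)
    (exact : ∀ (Q₁ Q₂ Q₃ : Type u) [AddCommGroup Q₁] [Module S Q₁] [AddCommGroup Q₂] [Module S Q₂]
      [AddCommGroup Q₃] [Module S Q₃] (f : Q₁ →ₗ[S] Q₂) (g : Q₂ →ₗ[S] Q₃),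
      Function.Injective f → Function.Surjective g → Function.Exact f g →
      motive Q₁ → motive Q₃ → motive Q₂)
    (Q : Type u) [AddCommGroup Q] [Module S Q] [hQ : Module.Finite S Q] : motive Q := by
  suffices H : ∀ (I : Ideal S) (Q : Type u) [AddCommGroup Q] [Module S Q] [Module.Finite S Q],
      (∀ r ∈ I, ∀ x : Q, r • x = 0) → motive Q from
    H ⊥ Q (fun r hr x => by rw [(Submodule.mem_bot S).mp hr, zero_smul])
  intro I
  -- noetherian induction on the annihilating ideal
  induction I using WellFoundedGT.induction with
  | ind I IH =>
  intro Q _ _ hQ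
  induction hQ using IsNoetherianRing.induction_on_isQuotientEquivQuotientPrime S with
  | subsingleton N => exact fun _ => subsingleton N inferInstance
  | exact N₁ N₂ N₃ f g hf hg hfg h₁ h₃ =>
    intro hann
    refine exact N₁ N₂ N₃ f g hf hg hfg (h₁ fun r hr x => hf ?_) (h₃ fun r hr x => ?_)
    · rw [map_smul, hann r hr, map_zero]
    · obtain ⟨y, rfl⟩ := hg x
      rw [← map_smul, hann r hr, map_zero]
  | quotient N p f =>
    intro hann
    by_cases hp : p.1 = maximalIdeal S
    · exact residue N (f.trans (Submodule.quotEquivOfEq _ _ hp))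
    · obtain ⟨s, hs, hsp⟩ := Set.exists_of_ssubset ((le_maximalIdeal p.2.ne_top).lt_of_ne hp)
      have hIp : I ≤ p.1 := fun r hr => by
        have := congrArg f (hann r hr (f.symm 1))
        rw [map_smul, map_zero, f.apply_symm_apply] at this
        rw [← Ideal.Quotient.eq_zero_iff_mem, ← this, Algebra.smul_def, mul_one]
        rfl
      have hreg := isSMulRegular_of_equiv_quotient_prime f p.2 hsp
      refine regular N s hs hreg (IH (p.1 ⊔ Ideal.span {s}) ?_ (QuotSMulTop s N) ?_)
      · refine lt_of_le_of_lt hIp (lt_of_le_of_ne le_sup_left fun h => hsp ?_)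
        have : s ∈ p.1 ⊔ Ideal.span {s} := Ideal.mem_sup_right (Ideal.mem_span_singleton_self s)
        rwa [← h] at this
      · intro r hr z
        obtain ⟨x, rfl⟩ := Submodule.Quotient.mk_surjective _ z
        obtain ⟨a, ha, b, hb, rfl⟩ := Submodule.mem_sup.mp hr
        obtain ⟨c, rfl⟩ := Ideal.mem_span_singleton'.mp hb
        have hpx : a • x = 0 := f.injective (by
          obtain ⟨t, ht⟩ := Ideal.Quotient.mk_surjective (f x)
          rw [map_smul, map_zero, ← ht, ← Ideal.Quotient.mk_eq_mk, ← Submodule.Quotient.mk_smul,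
            Ideal.Quotient.mk_eq_mk, Ideal.Quotient.eq_zero_iff_mem]
          exact p.1.mul_mem_right t ha)
        rw [← Submodule.Quotient.mk_smul, add_smul, hpx, zero_add, Submodule.Quotient.mk_eq_zero,
          mul_comm, mul_smul]
        exact Submodule.smul_mem_pointwise_smul _ _ ⊤ trivial

variable [IsNoetherianRing T] [Module.Finite T P] [Module.Flat S Y]

/-- Local criterion of flatness: if `w : P → Y` is injective modulo the maximal ideal of `S` and
`Y` is `S`-flat, then `w` remains injective after `- ⊗ Q` for every finite `S`-module `Q`. -/
theorem rTensor_injective_of_fibre (hm : (maximalIdeal S).map (algebraMap S T) ≤ Ideal.jacobson ⊥)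
    (w : P →ₗ[T] Y) (hw : ∀ x : P, w x ∈ maximalIdeal S • (⊤ : Submodule S Y) →
      x ∈ maximalIdeal S • (⊤ : Submodule S P))
    (Q : Type u) [AddCommGroup Q] [Module S Q] [Module.Finite S Q] :
    Function.Injective ((w.restrictScalars S).rTensor Q) := by
  refine finite_module_devissage (S := S) (motive := fun Q _ _ =>
    Function.Injective ((w.restrictScalars S).rTensor Q)) ?_ ?_ ?_ ?_ Q
  · intro Q _ _ _
    have : Subsingleton (P ⊗[S] Q) := inferInstance
    exact Function.injective_of_subsingleton _
  · intro Q _ _ e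
    refine (injective_iff_map_eq_zero _).mpr fun z hz => ?_
    obtain ⟨x, rfl⟩ := (tmul_generator e P).1 z
    rw [LinearMap.rTensor_tmul, LinearMap.restrictScalars_apply, (tmul_generator e Y).2] at hz
    exact ((tmul_generator e P).2 x).mpr (hw x hz)
  · intro Q _ _ _ s hs hreg h
    let W : P ⊗[S] Q →ₗ[T] Y ⊗[S] Q := AlgebraTensorModule.rTensor S Q w
    have : Module.Finite T (P ⊗[S] Q) := finite_tensorProduct_left Q
    have hbot : LinearMap.ker W = ⊥ := by
      refine Submodule.eq_bot_of_le_smul_of_le_jacobson_bot _ _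
        (Module.Finite.iff_fg.mp inferInstance) (fun z hz => ?_) hm
      have hz' : (w.restrictScalars S).rTensor Q z = 0 := hz
      have hz₃ : (Submodule.mkQ (s • (⊤ : Submodule S Q))).lTensor P z = 0 := h (by
        rw [map_zero, ← LinearMap.comp_apply, LinearMap.rTensor_comp_lTensor,
          ← LinearMap.lTensor_comp_rTensor, LinearMap.comp_apply, hz', map_zero])
      obtain ⟨z', rfl⟩ := exists_smul_eq_of_lTensor_mkQ_eq_zero hz₃
      rw [← algebraMap_smul T s z']
      refine Submodule.smul_mem_smul (Ideal.mem_map_of_mem _ hs) ?_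
      refine isSMulRegular_tensorProduct (Y := Y) hreg ?_
      simp only [smul_zero]
      rw [← hz', map_smul]
      rfl
    exact (LinearMap.ker_eq_bot (f := W)).mp hbot
  · intro Q₁ Q₂ Q₃ _ _ _ _ _ _ f g hf hg hfg h₁ h₃
    refine (injective_iff_map_eq_zero _).mpr fun z hz => ?_
    have hz₃ : g.lTensor P z = 0 := h₃ (by
      rw [map_zero, ← LinearMap.comp_apply, LinearMap.rTensor_comp_lTensor,
        ← LinearMap.lTensor_comp_rTensor, LinearMap.comp_apply, hz, map_zero])
    obtain ⟨z₁, rfl⟩ := (lTensor_exact P hfg hg z).mp hz₃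
    have : z₁ = 0 := h₁ (Module.Flat.lTensor_preserves_injective_linearMap (M := Y) f hf (by
      rw [map_zero, map_zero, ← LinearMap.comp_apply, LinearMap.lTensor_comp_rTensor,
        ← LinearMap.rTensor_comp_lTensor, LinearMap.comp_apply, hz]))
    rw [this, map_zero]

/-- Local criterion of flatness: the cokernel of a map `P → Y` with `S`-flat target is `S`-flat if
the map is injective modulo the maximal ideal of `S`. -/
theorem flat_quotient_range_of_fibre
    (hm : (maximalIdeal S).map (algebraMap S T) ≤ Ideal.jacobson ⊥)
    (w : P →ₗ[T] Y) (hw : ∀ x : P, w x ∈ maximalIdeal S • (⊤ : Submodule S Y) →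
      x ∈ maximalIdeal S • (⊤ : Submodule S P)) :
    Module.Flat S (Y ⧸ LinearMap.range w) := by
  let w' := w.restrictScalars S
  let c := (LinearMap.range w).mkQ.restrictScalars S
  have hc : Function.Surjective c := Submodule.mkQ_surjective (LinearMap.range w)
  have hex : Function.Exact w' c := fun x => by
    change (LinearMap.range w).mkQ x = 0 ↔ x ∈ Set.range w
    simp
  refine Module.Flat.iff_lTensor_injective'.mpr fun I =>
    (injective_iff_map_eq_zero _).mpr fun z hz => ?_
  obtain ⟨y, rfl⟩ := LinearMap.rTensor_surjective I hc z
  have hy : c.rTensor S (I.subtype.lTensor Y y) = 0 := by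
    rw [← LinearMap.comp_apply, LinearMap.rTensor_comp_lTensor, ← LinearMap.lTensor_comp_rTensor,
      LinearMap.comp_apply, hz]
  obtain ⟨a, ha⟩ := (rTensor_exact S hex hc _).mp hy
  -- `a` vanishes in `P ⊗ S / I`, since its image in `Y` lies in `I Y`
  have hinj : Function.Injective (w'.rTensor (S ⧸ I)) :=
    rTensor_injective_of_fibre hm w hw (S ⧸ I)
  have ha' : (Submodule.mkQ I).lTensor P a = 0 := by
    apply hinj
    rw [map_zero, ← LinearMap.comp_apply, LinearMap.rTensor_comp_lTensor,
      ← LinearMap.lTensor_comp_rTensor, LinearMap.comp_apply, ha, ← LinearMap.comp_apply,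
      ← LinearMap.lTensor_comp]
    have : Submodule.mkQ I ∘ₗ I.subtype = 0 :=
      (LinearMap.exact_subtype_mkQ I).linearMap_comp_eq_zero
    rw [this, LinearMap.lTensor_zero, LinearMap.zero_apply]
  obtain ⟨b, rfl⟩ := (lTensor_exact P (LinearMap.exact_subtype_mkQ I) (Submodule.mkQ_surjective I)
    a).mp ha'
  have : y = w'.rTensor I b :=
    Module.Flat.lTensor_preserves_injective_linearMap (M := Y) I.subtype I.subtype_injective (by
      rw [← ha, ← LinearMap.comp_apply, ← LinearMap.comp_apply, LinearMap.rTensor_comp_lTensor,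
        LinearMap.lTensor_comp_rTensor])
  rw [this, ← LinearMap.comp_apply, ← LinearMap.rTensor_comp, hex.linearMap_comp_eq_zero,
    LinearMap.rTensor_zero, LinearMap.zero_apply]

end LocalCriterion

end Flatness

/-! ### Extending semilinear maps along a syzygy -/

section Extension

variable {R T : Type u} [CommRing R] [CommRing T] (φ : R →+* T) {r : ℕ}

/-- The semilinear map from the free module `R^r` which sends the basis vector `e_i` to `v_i`. -/
def semilinearComb {W : Type*} [AddCommGroup W] [Module T W] (v : Fin r → W) :
    (Fin r → R) →ₛₗ[φ] W where
  toFun x := ∑ i, φ (x i) • v i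
  map_add' x y := by simp [add_smul, Finset.sum_add_distrib]
  map_smul' a x := by simp [mul_smul, Finset.smul_sum]

@[simp] theorem semilinearComb_apply {W : Type*} [AddCommGroup W] [Module T W] (v : Fin r → W)
    (x : Fin r → R) : semilinearComb φ v x = ∑ i, φ (x i) • v i := rfl

variable {K : Type*} [AddCommGroup K] [Module R K]

/-- Every `φ`-semilinear map `K → W` extends along `ι : K → R^r`. If `ι` is the kernel of a
surjection `R^r → X`, this says that `Ext^1_R(X, W) = 0`. -/
def ExtendsAlong (ι : K →ₗ[R] (Fin r → R)) (W : Type*) [AddCommGroup W] [Module T W] : Prop :=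
  ∀ g : K →ₛₗ[φ] W, ∃ v : Fin r → W, ∀ y, g y = semilinearComb φ v (ι y)

variable {φ} {ι : K →ₗ[R] (Fin r → R)}

/-- If maps to the quotient `W₃` extend, then every map to `W₂` is the sum of one that extends and
one with values in the submodule `W₁`. -/
theorem ExtendsAlong.exists_sub_factor {W₁ W₂ W₃ : Type*} [AddCommGroup W₁] [Module T W₁]
    [AddCommGroup W₂] [Module T W₂] [AddCommGroup W₃] [Module T W₃] (j : W₁ →ₗ[T] W₂)
    (π : W₂ →ₗ[T] W₃) (hj : Function.Injective j) (hπ : Function.Surjective π)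
    (hex : Function.Exact j π) (h : ExtendsAlong φ ι W₃) (g : K →ₛₗ[φ] W₂) :
    ∃ (v : Fin r → W₂) (g₁ : K →ₛₗ[φ] W₁), ∀ y, g y = semilinearComb φ v (ι y) + j (g₁ y) := by
  obtain ⟨v₃, hv₃⟩ := h (π.comp g)
  choose v hv using fun i => hπ (v₃ i)
  let g' : K →ₛₗ[φ] W₂ := g - (semilinearComb φ v).comp ι
  have hg' : ∀ y, g' y ∈ LinearMap.range j := fun y => (hex _).mp (by
    have := hv₃ y
    simp only [LinearMap.comp_apply] at this
    simp [g', this, hv])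
  refine ⟨v, (LinearEquiv.ofInjective j hj).symm.toLinearMap.comp (g'.codRestrict _ hg'),
    fun y => ?_⟩
  have : j ((LinearEquiv.ofInjective j hj).symm ⟨g' y, hg' y⟩) = g' y :=
    congrArg Subtype.val ((LinearEquiv.ofInjective j hj).apply_symm_apply ⟨g' y, hg' y⟩)
  refine (add_eq_of_eq_sub' ?_).symm
  exact this

theorem ExtendsAlong.of_exact {W₁ W₂ W₃ : Type*} [AddCommGroup W₁] [Module T W₁]
    [AddCommGroup W₂] [Module T W₂] [AddCommGroup W₃] [Module T W₃] (j : W₁ →ₗ[T] W₂)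
    (π : W₂ →ₗ[T] W₃) (hj : Function.Injective j) (hπ : Function.Surjective π)
    (hex : Function.Exact j π) (h₁ : ExtendsAlong φ ι W₁) (h₃ : ExtendsAlong φ ι W₃) :
    ExtendsAlong φ ι W₂ := fun g => by
  obtain ⟨v, g₁, hg⟩ := h₃.exists_sub_factor j π hj hπ hex g
  obtain ⟨v₁, hv₁⟩ := h₁ g₁
  exact ⟨fun i => v i + j (v₁ i), fun y => by
    simp [hg, hv₁, smul_add, Finset.sum_add_distrib]⟩

theorem finite_semilinearMap [IsNoetherianRing T] [Module.Finite R K] (W : Type*) [AddCommGroup W]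
    [Module T W] [Module.Finite T W] : Module.Finite T (K →ₛₗ[φ] W) := by
  obtain ⟨n, k, hk⟩ := Module.Finite.exists_fin (R := R) (M := K)
  let ev : (K →ₛₗ[φ] W) →ₗ[T] (Fin n → W) :=
    { toFun := fun g i => g (k i), map_add' := fun _ _ => rfl, map_smul' := fun _ _ => rfl }
  refine Module.Finite.of_injective ev fun g g' h => LinearMap.ext_on hk ?_
  rintro _ ⟨i, rfl⟩
  exact congrFun h i

variable {G : Type u} [AddCommGroup G] [Module T G] {A : Type u} [CommRing A]
  {ρ : T →+* A} {σ : R →+* A} [RingHomCompTriple φ ρ σ]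
  {L : Type*} [AddCommGroup L] [Module A L]

/-- Maps to `W` extend if maps to `L` do, where `W` and `L` are quotients of `G` by the same
submodule. -/
theorem ExtendsAlong.of_ker_eq {W : Type*} [AddCommGroup W] [Module T W] (a : G →ₗ[T] W)
    (ha : Function.Surjective a) (b : G →ₛₗ[ρ] L) (hb : Function.Surjective b)
    (hker : ∀ x, a x = 0 ↔ b x = 0) (h : ExtendsAlong σ ι L) : ExtendsAlong φ ι W := fun g => by
  have hab : ∀ x x', a x = a x' ↔ b x = b x' := fun x x' => by
    rw [← sub_eq_zero, ← map_sub, hker, map_sub, sub_eq_zero]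
  choose c hc using ha
  let g' : K →ₛₗ[σ] L :=
    { toFun := fun y => b (c (g y))
      map_add' := fun y y' => by
        rw [← map_add, ← hab]
        simp [hc]
      map_smul' := fun t y => by
        rw [← RingHomCompTriple.comp_apply (σ₁₂ := φ) (σ₂₃ := ρ), ← map_smulₛₗ, ← hab]
        simp [hc] }
  obtain ⟨v, hv⟩ := h g'
  choose w hw using fun i => hb (v i)
  refine ⟨fun i => a (w i), fun y => ?_⟩
  have h₁ : b (c (g y)) = b (∑ i, φ (ι y i) • w i) := by
    refine (hv y).trans ?_
    simp [hw, RingHomCompTriple.comp_apply]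
  rw [← hab, hc] at h₁
  simp [h₁]

variable {S : Type u} [CommRing S] [IsLocalRing S] [IsNoetherianRing S] [Algebra S T]
  [IsNoetherianRing T] [Module.Finite R K] [Module S G] [IsScalarTower S T G] [Module.Flat S G]
  [Module.Finite T G]

/-- Base change for `Ext^1`: if `G` is a finite `T`-module, flat over `S`, and maps to the closed
fibre of `G` extend, then maps to `G ⊗ Q` extend for every finite `S`-module `Q`. -/
theorem extendsAlong_tensorProduct
    (hm : (maximalIdeal S).map (algebraMap S T) ≤ Ideal.jacobson ⊥)
    (b : G →ₛₗ[ρ] L) (hb : Function.Surjective b)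
    (hker : ∀ x, b x = 0 ↔ x ∈ maximalIdeal S • (⊤ : Submodule S G)) (hres : ExtendsAlong σ ι L)
    (Q : Type u) [AddCommGroup Q] [Module S Q] [Module.Finite S Q] :
    ExtendsAlong φ ι (G ⊗[S] Q) := by
  refine finite_module_devissage (S := S) (motive := fun Q _ _ => ExtendsAlong φ ι (G ⊗[S] Q))
    ?_ ?_ ?_ ?_ Q
  · intro Q _ _ _ g
    exact ⟨0, fun y => Subsingleton.elim _ _⟩
  · intro Q _ _ e
    let a : G →ₗ[T] G ⊗[S] Q :=
      { toFun := fun x => x ⊗ₜ e.symm 1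
        map_add' := fun x y => add_tmul _ _ _
        map_smul' := fun t x => rfl }
    exact hres.of_ker_eq a (tmul_generator e G).1 b hb
      fun x => ((tmul_generator e G).2 x).trans (hker x).symm
  · intro Q _ _ _ s hs hreg h
    have : Module.Finite T (G ⊗[S] Q) := finite_tensorProduct_left Q
    have : Module.Finite T (K →ₛₗ[φ] (G ⊗[S] Q)) := finite_semilinearMap _
    let E : Submodule T (K →ₛₗ[φ] (G ⊗[S] Q)) :=
      { carrier := {g | ∃ v : Fin r → _, ∀ y, g y = semilinearComb φ v (ι y)}
        add_mem' := by
          rintro g g' ⟨v, hv⟩ ⟨v', hv'⟩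
          exact ⟨v + v', fun y => by simp [hv, hv', smul_add, Finset.sum_add_distrib]⟩
        zero_mem' := ⟨0, fun y => by simp⟩
        smul_mem' := by
          rintro t g ⟨v, hv⟩
          exact ⟨t • v, fun y => by simp [hv, Finset.smul_sum, smul_comm t]⟩ }
    suffices H : (⊤ : Submodule T (K →ₛₗ[φ] (G ⊗[S] Q))) ≤ E from fun g => H trivial
    refine Submodule.le_of_le_smul_of_le_jacobson_bot (Module.Finite.iff_fg.mp inferInstance) hm
      fun g _ => ?_
    obtain ⟨v, g₁, hg⟩ := h.exists_sub_factor
      (AlgebraTensorModule.lTensor T G (LinearMap.lsmul S Q s))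
      (AlgebraTensorModule.lTensor T G (Submodule.mkQ (s • (⊤ : Submodule S Q))))
      (Module.Flat.lTensor_preserves_injective_linearMap _ hreg)
      (LinearMap.lTensor_surjective G (Submodule.mkQ_surjective _))
      (lTensor_exact G (exact_lsmul_mkQ Q s) (Submodule.mkQ_surjective _)) g
    have hsum : g = (semilinearComb φ v).comp ι + algebraMap S T s • g₁ := by
      ext y
      rw [hg, LinearMap.add_apply, LinearMap.smul_apply, algebraMap_smul, ← lTensor_lsmul]
      rfl
    rw [hsum]
    exact Submodule.add_mem_sup ⟨v, fun y => rfl⟩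
      (Submodule.smul_mem_smul (Ideal.mem_map_of_mem _ hs) trivial)
  · intro Q₁ Q₂ Q₃ _ _ _ _ _ _ f g hf hg hfg h₁ h₃
    exact h₁.of_exact (AlgebraTensorModule.lTensor T G f) (AlgebraTensorModule.lTensor T G g)
      (Module.Flat.lTensor_preserves_injective_linearMap f hf) (LinearMap.lTensor_surjective G hg)
      (lTensor_exact G hfg hg) h₃

/-- If maps to the closed fibre of `G` extend, then a map to `𝔪_S G` extends within `𝔪_S G`. -/
theorem exists_extension_smul_top
    (hm : (maximalIdeal S).map (algebraMap S T) ≤ Ideal.jacobson ⊥)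
    (b : G →ₛₗ[ρ] L) (hb : Function.Surjective b)
    (hker : ∀ x, b x = 0 ↔ x ∈ maximalIdeal S • (⊤ : Submodule S G)) (hres : ExtendsAlong σ ι L)
    (g : K →ₛₗ[φ] G) (hg : ∀ y, b (g y) = 0) :
    ∃ v : Fin r → G, (∀ i, b (v i) = 0) ∧ ∀ y, g y = semilinearComb φ v (ι y) := by
  let I := maximalIdeal S
  let j : G ⊗[S] I →ₗ[T] G := (AlgebraTensorModule.rid S T G).toLinearMap ∘ₗ
    AlgebraTensorModule.lTensor T G I.subtype
  have hj : Function.Injective j := (AlgebraTensorModule.rid S T G).injective.comp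
    (Module.Flat.lTensor_preserves_injective_linearMap I.subtype I.subtype_injective)
  have hjt : ∀ (x : G) (s : I), j (x ⊗ₜ s) = (s : S) • x := fun x s => by simp [j]
  have hrange : ∀ x, b x = 0 ↔ x ∈ LinearMap.range j := fun x => by
    rw [hker]
    constructor
    · intro hx
      refine Submodule.smul_induction_on hx (fun s hs y _ => ⟨y ⊗ₜ ⟨s, hs⟩, hjt _ _⟩)
        fun x y hx hy => add_mem hx hy
    · rintro ⟨z, rfl⟩
      induction z with
      | zero => rw [map_zero]; exact zero_mem _
      | tmul x s => rw [hjt]; exact Submodule.smul_mem_smul s.2 trivial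
      | add x y hx hy => rw [map_add]; exact add_mem hx hy
  obtain ⟨v, hv⟩ := extendsAlong_tensorProduct hm b hb hker hres I
    ((LinearEquiv.ofInjective j hj).symm.toLinearMap.comp
      (g.codRestrict _ fun y => (hrange _).mp (hg y)))
  refine ⟨fun i => j (v i), fun i => (hrange _).mpr ⟨v i, rfl⟩, fun y => ?_⟩
  have h₁ := congrArg j (hv y)
  have h₂ : j ((LinearEquiv.ofInjective j hj).symm ⟨g y, (hrange _).mp (hg y)⟩) = g y :=
    congrArg Subtype.val ((LinearEquiv.ofInjective j hj).apply_symm_apply ⟨g y, _⟩)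
  rw [← h₂]
  refine h₁.trans ?_
  simp

end Extension

end CMDef

namespace CMDef

/-! ### Closed fibres of rings and modules -/

open IsLocalRing

section Fibre

/-- `ρ : T → A` is the closed fibre of the `S`-algebra `T`, i.e. `A = T / 𝔪_S T`, where `𝔪_S T`
is contained in the Jacobson radical. -/
structure IsClosedFibre (S : Type*) {T A : Type*} [CommRing S] [IsLocalRing S] [CommRing T]
    [Algebra S T] [CommRing A] (ρ : T →+* A) : Prop where
  surjective : Function.Surjective ρ
  ker_eq : RingHom.ker ρ = (maximalIdeal S).map (algebraMap S T)
  le_jacobson : (maximalIdeal S).map (algebraMap S T) ≤ Ideal.jacobson ⊥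

/-- `α : X → N` is the closed fibre of the `S`-module `X`, i.e. `N = X / 𝔪_S X`. -/
structure IsFibreMap (S : Type*) {T A X N : Type*} [CommRing S] [IsLocalRing S] [CommRing T]
    [CommRing A] {ρ : T →+* A} [AddCommGroup X] [Module S X] [Module T X] [AddCommGroup N]
    [Module A N] (α : X →ₛₗ[ρ] N) : Prop where
  surjective : Function.Surjective α
  eq_zero_iff : ∀ x, α x = 0 ↔ x ∈ maximalIdeal S • (⊤ : Submodule S X)

variable {S T A : Type*} [CommRing S] [CommRing T] [Algebra S T]

theorem mem_map_smul_top_iff {X : Type*} [AddCommGroup X] [Module S X] [Module T X]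
    [IsScalarTower S T X] (I : Ideal S) (x : X) :
    x ∈ I.map (algebraMap S T) • (⊤ : Submodule T X) ↔ x ∈ I • (⊤ : Submodule S X) := by
  rw [← Submodule.restrictScalars_mem S, Ideal.smul_restrictScalars, Submodule.restrictScalars_top]

/-- `mem_smul_ker_of_flat` for the extension of an ideal of `S` to `T`. -/
theorem mem_map_smul_ker_of_flat {F X : Type*} [AddCommGroup F] [Module T F] [AddCommGroup X]
    [Module S X] [Module T X] [IsScalarTower S T X] [Module.Flat S X] (q : F →ₗ[T] X)
    (hq : Function.Surjective q) (I : Ideal S) {x : F}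
    (hx : x ∈ I.map (algebraMap S T) • (⊤ : Submodule T F)) (hqx : q x = 0) :
    x ∈ I.map (algebraMap S T) • LinearMap.ker q := by
  let _ : Module S F := Module.compHom F (algebraMap S T)
  have : IsScalarTower S T F := ⟨fun s t x => by
    rw [Algebra.smul_def, mul_smul]; rfl⟩
  rw [← Submodule.restrictScalars_mem S, Ideal.smul_restrictScalars]
  exact mem_smul_ker_of_flat (q.restrictScalars S) hq I ((mem_map_smul_top_iff I x).mp hx) hqx

theorem isBaseChange_of_bijective {B X Y : Type*} [CommRing B] [Algebra T B] [AddCommGroup X]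
    [Module T X] [AddCommGroup Y] [Module T Y] [Module B Y] [IsScalarTower T B Y] (α : X →ₗ[T] Y)
    (h : Function.Bijective (α.liftBaseChange B)) : IsBaseChange B α :=
  .of_equiv (LinearEquiv.ofBijective _ h) fun x => by simp

/-- Along a surjection of rings `T → B` with kernel `J`, base change is reduction modulo `J`. -/
theorem isBaseChange_iff_of_surjective {B X Y : Type*} [CommRing B] [Algebra T B]
    (hB : Function.Surjective (algebraMap T B)) [AddCommGroup X] [Module T X] [AddCommGroup Y]
    [Module T Y] [Module B Y] [IsScalarTower T B Y] (α : X →ₗ[T] Y) :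
    IsBaseChange B α ↔ Function.Surjective α ∧
      ∀ x, α x = 0 ↔ x ∈ RingHom.ker (algebraMap T B) • (⊤ : Submodule T X) := by
  have hone : ∀ z : B ⊗[T] X, ∃ x : X, (1 : B) ⊗ₜ[T] x = z := fun z => by
    induction z with
    | zero => exact ⟨0, tmul_zero _ _⟩
    | tmul b x =>
      obtain ⟨t, rfl⟩ := hB b
      exact ⟨t • x, by rw [tmul_smul, smul_tmul', Algebra.smul_def, mul_one]⟩
    | add a b ha hb =>
      obtain ⟨x, rfl⟩ := ha
      obtain ⟨y, rfl⟩ := hb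
      exact ⟨x + y, tmul_add _ _ _⟩
  have hker : ∀ x : X, (1 : B) ⊗ₜ[T] x = 0 ↔
      x ∈ RingHom.ker (algebraMap T B) • (⊤ : Submodule T X) := fun x => by
    constructor
    · intro h
      let e : (T ⧸ RingHom.ker (algebraMap T B)) ≃ₗ[T] B :=
        (Ideal.quotientKerAlgEquivOfSurjective (f := Algebra.ofId T B) hB).toLinearEquiv
      have he : e 1 = 1 :=
        map_one (Ideal.quotientKerAlgEquivOfSurjective (f := Algebra.ofId T B) hB)
      have h' : (1 : T ⧸ RingHom.ker (algebraMap T B)) ⊗ₜ[T] x = 0 := by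
        apply (TensorProduct.congr e (LinearEquiv.refl T X)).injective
        rw [congr_tmul, he, map_zero]
        exact h
      have h'' := congrArg (quotTensorEquivQuotSMul X (RingHom.ker (algebraMap T B))) h'
      rw [map_zero, ← map_one (Ideal.Quotient.mk (RingHom.ker (algebraMap T B))),
        quotTensorEquivQuotSMul_mk_tmul, one_smul] at h''
      exact (Submodule.Quotient.mk_eq_zero _).mp h''
    · intro h
      refine Submodule.smul_induction_on h (fun t ht y _ => ?_) fun y z hy hz => ?_
      · rw [tmul_smul, smul_tmul', Algebra.smul_def, (RingHom.mem_ker).mp ht, zero_mul, zero_tmul]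
      · rw [tmul_add, hy, hz, add_zero]
  constructor
  · intro h
    refine ⟨fun y => ?_, fun x => ?_⟩
    · obtain ⟨x, hx⟩ := hone (h.equiv.symm y)
      refine ⟨x, ?_⟩
      have := h.equiv_tmul 1 x
      rw [hx, one_smul, LinearEquiv.apply_symm_apply] at this
      exact this.symm
    · rw [← hker, ← h.equiv.map_eq_zero_iff, h.equiv_tmul, one_smul]
  · rintro ⟨hs, hk⟩
    refine isBaseChange_of_bijective α ⟨(injective_iff_map_eq_zero _).mpr fun z hz => ?_,
      fun y => ?_⟩
    · obtain ⟨x, rfl⟩ := hone z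
      rw [LinearMap.liftBaseChange_tmul, one_smul, hk] at hz
      exact (hker x).mpr hz
    · obtain ⟨x, rfl⟩ := hs y
      exact ⟨1 ⊗ₜ x, by rw [LinearMap.liftBaseChange_tmul, one_smul]⟩

theorem mem_smul_top_pi_iff (I : Ideal S) {r : ℕ} (x : Fin r → T) :
    x ∈ I • (⊤ : Submodule S (Fin r → T)) ↔ ∀ i, x i ∈ I.map (algebraMap S T) := by
  have hT : ∀ t : T, t ∈ I.map (algebraMap S T) ↔ t ∈ I • (⊤ : Submodule S T) := fun t => by
    rw [← mem_map_smul_top_iff (T := T), smul_eq_mul, Ideal.mul_top]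
  constructor
  · intro h i
    rw [hT]
    have : I • (⊤ : Submodule S (Fin r → T)) ≤
        (I • (⊤ : Submodule S T)).comap (LinearMap.proj i) := by
      rw [← Submodule.map_le_iff_le_comap, Submodule.map_smul'']
      exact Submodule.smul_mono le_rfl le_top
    exact this h
  · intro h
    have hx : x = ∑ i, LinearMap.single S (fun _ : Fin r => T) i (x i) := by
      ext j
      simp [Pi.single_apply]
    rw [hx]
    refine Submodule.sum_mem _ fun i _ => ?_
    have : Submodule.map (LinearMap.single S (fun _ : Fin r => T) i) (I • ⊤) ≤ I • ⊤ := by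
      rw [Submodule.map_smul'']
      exact Submodule.smul_mono le_rfl le_top
    exact this ⟨x i, (hT _).mp (h i), rfl⟩

variable [IsLocalRing S] [CommRing A] {ρ : T →+* A}

theorem IsClosedFibre.isBaseChange_iff [Algebra T A] {X N : Type*} [AddCommGroup X] [Module S X]
    [Module T X] [IsScalarTower S T X] [AddCommGroup N] [Module T N] [Module A N]
    [IsScalarTower T A N] (hρ : IsClosedFibre S (algebraMap T A)) (α : X →ₗ[T] N) :
    IsBaseChange A α ↔ Function.Surjective α ∧
      ∀ x, α x = 0 ↔ x ∈ maximalIdeal S • (⊤ : Submodule S X) := by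
  rw [isBaseChange_iff_of_surjective hρ.surjective, hρ.ker_eq]
  simp only [mem_map_smul_top_iff]

theorem IsClosedFibre.isCocartesianHom_iff {T A X N : Type u} [CommRing T] [Algebra S T]
    [CommRing A] {ρ : T →+* A} [AddCommGroup X] [Module S X]
    [Module T X] [IsScalarTower S T X] [AddCommGroup N] [Module A N]
    (hρ : IsClosedFibre S ρ) (α : X →ₛₗ[ρ] N) : IsCocartesianHom ρ α ↔ IsFibreMap S α := by
  let _ : Algebra T A := ρ.toAlgebra
  let _ : Module T N := Module.compHom N ρ
  have : IsScalarTower T A N := ⟨fun a b x => mul_smul (ρ a) b x⟩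
  have hρ' : IsClosedFibre S (algebraMap T A) := hρ
  refine (hρ'.isBaseChange_iff (N := N)
    { toFun := α, map_add' := α.map_add, map_smul' := α.map_smulₛₗ }).trans
    ⟨fun h => ⟨h.1, h.2⟩, fun h => ⟨h.1, h.2⟩⟩

/-- The `A`-module `N` is the base change of `X`, if `X → N` is the closed fibre. -/
theorem IsFibreMap.exists_tensorProduct_equiv [Algebra T A] {X N : Type*} [AddCommGroup X]
    [Module S X] [Module T X] [IsScalarTower S T X] [AddCommGroup N] [Module A N]
    {α : X →ₛₗ[algebraMap T A] N} (hα : IsFibreMap S α) (hρ : IsClosedFibre S (algebraMap T A)) :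
    Nonempty (A ⊗[T] X ≃ₗ[A] N) := by
  let _ : Module T N := Module.compHom N (algebraMap T A)
  have : IsScalarTower T A N := ⟨fun a b x => by
    rw [Algebra.smul_def]; exact mul_smul (algebraMap T A a) b x⟩
  exact ⟨((hρ.isBaseChange_iff (N := N)
    { toFun := α, map_add' := α.map_add, map_smul' := α.map_smulₛₗ }).mpr
      ⟨hα.1, hα.2⟩).equiv⟩

/-- The kernel of a surjection onto a flat module commutes with passing to the closed fibre. -/
theorem IsFibreMap.exists_ker {Y X M N : Type*} [AddCommGroup Y] [Module S Y] [Module T Y]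
    [IsScalarTower S T Y] [AddCommGroup X] [Module S X] [Module T X] [IsScalarTower S T X]
    [Module.Flat S X] [AddCommGroup M] [Module A M] [AddCommGroup N] [Module A N]
    {αY : Y →ₛₗ[ρ] M} {αX : X →ₛₗ[ρ] N} (hY : IsFibreMap S αY) (hX : IsFibreMap S αX)
    (π : Y →ₗ[T] X) (hπ : Function.Surjective π) (p : M →ₗ[A] N) (hp : ∀ y, p (αY y) = αX (π y)) :
    ∃ α : LinearMap.ker π →ₛₗ[ρ] LinearMap.ker p, (∀ y, (α y : M) = αY y) ∧ IsFibreMap S α := by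
  have hmem : ∀ y : LinearMap.ker π, (αY.comp (LinearMap.ker π).subtype) y ∈ LinearMap.ker p :=
    fun y => by
      rw [LinearMap.mem_ker, LinearMap.comp_apply, hp, Submodule.subtype_apply,
        LinearMap.mem_ker.mp y.2, map_zero]
  refine ⟨(αY.comp (LinearMap.ker π).subtype).codRestrict _ hmem, fun y => rfl, ⟨?_, ?_⟩⟩
  · rintro ⟨m, hm⟩
    obtain ⟨y, rfl⟩ := hY.surjective m
    rw [LinearMap.mem_ker, hp, hX.eq_zero_iff] at hm
    have htop : (⊤ : Submodule S X) = (⊤ : Submodule S Y).map (π.restrictScalars S) := by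
      rw [Submodule.map_top, LinearMap.range_eq_top.mpr]; exact hπ
    rw [htop, ← Submodule.map_smul''] at hm
    obtain ⟨z, hz, hzy⟩ := hm
    have hzy' : π z = π y := hzy
    refine ⟨⟨y - z, by rw [LinearMap.mem_ker, map_sub, hzy', sub_self]⟩, Subtype.ext ?_⟩
    change αY (y - z) = αY y
    rw [map_sub, (hY.eq_zero_iff z).mpr hz, sub_zero]
  · rintro ⟨y, hy⟩
    have h₁ : ∀ I : Ideal S, Submodule.map ((LinearMap.ker π).subtype.restrictScalars S)
        (I • ⊤) = I • LinearMap.ker (π.restrictScalars S) := fun I => by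
      rw [Submodule.map_smul'', Submodule.map_top]
      congr 1
      ext z
      simp
    rw [Subtype.ext_iff]
    change αY y = 0 ↔ _
    rw [hY.eq_zero_iff]
    constructor
    · intro h
      have h₂ := mem_smul_ker_of_flat (π.restrictScalars S) hπ (maximalIdeal S) h hy
      rw [← h₁] at h₂
      obtain ⟨z, hz, hzy⟩ := h₂
      have : z = ⟨y, hy⟩ := Subtype.ext hzy
      exact this ▸ hz
    · intro h
      have h₂ : y ∈ Submodule.map ((LinearMap.ker π).subtype.restrictScalars S)
        (maximalIdeal S • ⊤) := ⟨_, h, rfl⟩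
      rw [h₁] at h₂
      exact Submodule.smul_mono le_rfl le_top h₂

/-- The closed fibre of a finite free module. -/
theorem IsClosedFibre.exists_pi (hρ : IsClosedFibre S ρ) (r : ℕ) :
    ∃ α : (Fin r → T) →ₛₗ[ρ] (Fin r → A), (∀ x i, α x i = ρ (x i)) ∧ IsFibreMap S α := by
  let α : (Fin r → T) →ₛₗ[ρ] (Fin r → A) :=
    { toFun := fun x i => ρ (x i)
      map_add' := fun x y => funext fun i => map_add ρ (x i) (y i)
      map_smul' := fun t x => funext fun i => map_mul ρ t (x i) }
  refine ⟨α, fun x i => rfl, ⟨fun x => ?_, fun x => ?_⟩⟩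
  · choose y hy using fun i => hρ.surjective (x i)
    exact ⟨y, funext hy⟩
  · rw [mem_smul_top_pi_iff, ← hρ.ker_eq]
    exact funext_iff

end Fibre
end CMDef

namespace CMDef

/-! ### Lifting maps of flat modules from the closed fibre -/

open IsLocalRing Abelian

section Lifting

variable {S T A : Type u} [CommRing S] [IsLocalRing S] [CommRing T] [Algebra S T] [CommRing A]
  {ρ : T →+* A}

/-- If `Y` is `S`-flat with closed fibre `M`, then maps from a syzygy of `Y` to an `A`-module `L`
with `Ext^1_A(M, L) = 0` extend, i.e. `Ext^1_T(Y, L) = 0`. -/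
theorem IsFibreMap.extendsAlong {Y M L : Type u} [AddCommGroup Y] [Module S Y] [Module T Y]
    [IsScalarTower S T Y] [Module.Flat S Y] [AddCommGroup M] [Module A M] [AddCommGroup L]
    [Module A L] (hρ : IsClosedFibre S ρ) {αY : Y →ₛₗ[ρ] M} (hY : IsFibreMap S αY) {r : ℕ}
    (q : (Fin r → T) →ₗ[T] Y) (hq : Function.Surjective q)
    (hext : Subsingleton (Ext (ModuleCat.of A M) (ModuleCat.of A L) 1)) :
    ExtendsAlong ρ (LinearMap.ker q).subtype L := fun g => by
  obtain ⟨αF, hαF, hF⟩ := hρ.exists_pi r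
  let q' : (Fin r → A) →ₗ[A] M := Fintype.linearCombination A fun i => αY (q (Pi.single i 1))
  have hq'q : ∀ x, q' (αF x) = αY (q x) := fun x => by
    conv_rhs => rw [pi_eq_sum_univ' x]
    simp [q', Fintype.linearCombination_apply, hαF]
  have hq' : Function.Surjective q' := fun m => by
    obtain ⟨y, rfl⟩ := hY.surjective m
    obtain ⟨x, rfl⟩ := hq y
    exact ⟨αF x, hq'q x⟩
  obtain ⟨αK, hαK, hK⟩ := hF.exists_ker hY q hq q' hq'q
  -- `g` kills `𝔪_S ker q`, so it factors through the closed fibre `ker q'` of `ker q`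
  have hg : ∀ x, αK x = 0 → g x = 0 := fun x hx => by
    refine Submodule.smul_induction_on ((hK.eq_zero_iff x).mp hx) (fun s hs y _ => ?_)
      fun y z hy hz => ?_
    · rw [← algebraMap_smul T, map_smulₛₗ]
      have : ρ (algebraMap S T s) = 0 := by
        rw [← RingHom.mem_ker, hρ.ker_eq]
        exact Ideal.mem_map_of_mem _ hs
      rw [this, zero_smul]
    · rw [map_add, hy, hz, add_zero]
  have hg' : ∀ x y, αK x = αK y → g x = g y := fun x y h => by
    rw [← sub_eq_zero, ← map_sub]
    exact hg _ (by rw [map_sub, h, sub_self])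
  choose c hc using hK.surjective
  let g₁ : LinearMap.ker q' →ₗ[A] L :=
    { toFun := fun z => g (c z)
      map_add' := fun z z' => by
        rw [← map_add]
        exact hg' _ _ (by simp [hc])
      map_smul' := fun a z => by
        obtain ⟨t, rfl⟩ := hρ.surjective a
        rw [RingHom.id_apply, ← map_smulₛₗ]
        exact hg' _ _ (by simp [hc]) }
  obtain ⟨g₂, hg₂⟩ := exists_extension_of_subsingleton_ext_one q' hq' hext g₁
  refine ⟨fun i => g₂ (Pi.single i 1), fun y => ?_⟩
  have h₁ : g y = g₁ (αK y) := hg' _ _ (hc _).symm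
  rw [h₁, ← hg₂, hαK]
  conv_lhs => rw [pi_eq_sum_univ' (αF (y : Fin r → T))]
  simp [hαF]

variable [IsNoetherianRing T] {S₀ T₀ : Type u} [CommRing S₀] [IsLocalRing S₀] [IsNoetherianRing S₀]
  [CommRing T₀] [Algebra S₀ T₀] [IsNoetherianRing T₀] {φ : T →+* T₀} {ρ₀ : T₀ →+* A}
  [RingHomCompTriple φ ρ₀ ρ]
  {Y X₀ Y₀ M M₀ N₀ : Type u}
  [AddCommGroup Y] [Module S Y] [Module T Y] [IsScalarTower S T Y] [Module.Flat S Y]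
  [Module.Finite T Y] [AddCommGroup M] [Module A M]
  [AddCommGroup X₀] [Module S₀ X₀] [Module T₀ X₀] [IsScalarTower S₀ T₀ X₀] [Module.Flat S₀ X₀]
  [AddCommGroup Y₀] [Module S₀ Y₀] [Module T₀ Y₀] [IsScalarTower S₀ T₀ Y₀] [Module.Flat S₀ Y₀]
  [Module.Finite T₀ Y₀] [AddCommGroup M₀] [Module A M₀] [AddCommGroup N₀] [Module A N₀]

/-- Lifting: let `Y` be flat over `S` with closed fibre `M`, and let `π₀ : Y₀ → X₀` be a surjection
of flat modules over `S₀` with closed fibre `p : M₀ → N₀`. If `Ext^1_A(M, ker p) = 0`, then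
compatible maps `Y → X₀` and `M → M₀` are induced by a map `Y → Y₀`. -/
theorem exists_lift (hρ : IsClosedFibre S ρ) (hρ₀ : IsClosedFibre S₀ ρ₀) {αY : Y →ₛₗ[ρ] M}
    (hY : IsFibreMap S αY) {βY : Y₀ →ₛₗ[ρ₀] M₀} (hY₀ : IsFibreMap S₀ βY) {βX : X₀ →ₛₗ[ρ₀] N₀}
    (hX₀ : IsFibreMap S₀ βX) (π₀ : Y₀ →ₗ[T₀] X₀) (hπ₀ : Function.Surjective π₀) (p : M₀ →ₗ[A] N₀)
    (hp : ∀ y, p (βY y) = βX (π₀ y))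
    (hext : Subsingleton (Ext (ModuleCat.of A M) (ModuleCat.of A (LinearMap.ker p)) 1))
    (a : Y →ₛₗ[φ] X₀) (h : M →ₗ[A] M₀) (hah : ∀ y, βX (a y) = p (h (αY y))) :
    ∃ b : Y →ₛₗ[φ] Y₀, (∀ y, π₀ (b y) = a y) ∧ ∀ y, βY (b y) = h (αY y) := by
  obtain ⟨βG, hβG, hG⟩ := hY₀.exists_ker hX₀ π₀ hπ₀ p hp
  have : Module.Flat S₀ (LinearMap.ker π₀) :=
    flat_ker (π₀.restrictScalars S₀) hπ₀
  obtain ⟨r, q, hq⟩ := Module.Finite.exists_fin' T Y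
  -- `Y₀` surjects onto the fibre product of `X₀` and `M₀` over `N₀`
  have hpull : ∀ (x : X₀) (m : M₀), βX x = p m → ∃ y, π₀ y = x ∧ βY y = m := fun x m hxm => by
    obtain ⟨y, rfl⟩ := hπ₀ x
    obtain ⟨g, hg⟩ := hG.surjective ⟨m - βY y, by
      rw [LinearMap.mem_ker, map_sub, hp, hxm, sub_self]⟩
    refine ⟨y + g, by rw [map_add, LinearMap.mem_ker.mp g.2, add_zero], ?_⟩
    rw [map_add, ← hβG, hg]
    exact add_sub_cancel _ _
  choose y₀ hy₀π hy₀β using fun i => hpull (a (q (Pi.single i 1))) (h (αY (q (Pi.single i 1))))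
    (hah _)
  have hφ : ∀ t, ρ₀ (φ t) = ρ t := fun t => RingHomCompTriple.comp_apply
  have hcπ : ∀ x, π₀ (semilinearComb φ y₀ x) = a (q x) := fun x => by
    conv_rhs => rw [pi_eq_sum_univ' x]
    simp [hy₀π]
  have hcβ : ∀ x, βY (semilinearComb φ y₀ x) = h (αY (q x)) := fun x => by
    conv_rhs => rw [pi_eq_sum_univ' x]
    simp [hy₀β, hφ]
  have hmem : ∀ x : LinearMap.ker q,
      ((semilinearComb φ y₀).comp (LinearMap.ker q).subtype) x ∈ LinearMap.ker π₀ := fun x => by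
    rw [LinearMap.mem_ker, LinearMap.comp_apply, hcπ, Submodule.subtype_apply,
      LinearMap.mem_ker.mp x.2, map_zero]
  obtain ⟨v, hv, hvx⟩ := exists_extension_smul_top (σ := ρ) (ι := (LinearMap.ker q).subtype)
    hρ₀.le_jacobson βG hG.surjective hG.eq_zero_iff (hY.extendsAlong hρ q hq hext)
    (((semilinearComb φ y₀).comp (LinearMap.ker q).subtype).codRestrict _ hmem) (fun x => by
      rw [Subtype.ext_iff, hβG]
      change βY (semilinearComb φ y₀ (x : Fin r → T)) = 0
      rw [hcβ, LinearMap.mem_ker.mp x.2, map_zero, map_zero])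
  let c : (Fin r → T) →ₛₗ[φ] Y₀ := semilinearComb φ fun i => y₀ i - v i
  have hc : ∀ x, c x = semilinearComb φ y₀ x - semilinearComb φ v x := fun x => by
    simp [c, smul_sub, Finset.sum_sub_distrib]
  have hker : LinearMap.ker q ≤ LinearMap.ker c := fun x hx => by
    have := congrArg Subtype.val (hvx ⟨x, hx⟩)
    rw [LinearMap.mem_ker, hc]
    exact sub_eq_zero.mpr this
  choose s hs using hq
  have hcs : ∀ x x', q x = q x' → c x = c x' := fun x x' hxx => by
    rw [← sub_eq_zero, ← map_sub]
    exact hker (by rw [LinearMap.mem_ker, map_sub, hxx, sub_self])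
  let b : Y →ₛₗ[φ] Y₀ :=
    { toFun := fun y => c (s y)
      map_add' := fun y y' => by
        rw [← map_add]
        exact hcs _ _ (by simp [hs])
      map_smul' := fun t y => by
        rw [← map_smulₛₗ]
        exact hcs _ _ (by simp [hs]) }
  refine ⟨b, fun y => ?_, fun y => ?_⟩
  · change π₀ (c (s y)) = a y
    rw [hc, map_sub, hcπ, hs, LinearMap.mem_ker.mp (semilinearComb φ v (s y)).2, sub_zero]
  · change βY (c (s y)) = h (αY y)
    have : βY (semilinearComb φ v (s y) : LinearMap.ker π₀) = 0 := by
      rw [← hβG]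
      simp [hv]
    rw [hc, map_sub, hcβ, hs, this, sub_zero]

end Lifting
end CMDef

namespace CMDef

/-! ### Modules over a flat deformation of `A` -/

open IsLocalRing Abelian

section FlatFamilies

variable {S T A : Type u} [CommRing S] [IsLocalRing S] [CommRing T] [Algebra S T] [CommRing A]
  {ρ : T →+* A}

theorem IsClosedFibre.map_algebraMap (hρ : IsClosedFibre S ρ) {s : S} (hs : s ∈ maximalIdeal S) :
    ρ (algebraMap S T s) = 0 := by
  rw [← RingHom.mem_ker, hρ.ker_eq]
  exact Ideal.mem_map_of_mem _ hs

theorem IsClosedFibre.map_eq_zero {X N : Type*} [AddCommGroup X] [Module S X] [Module T X]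
    [IsScalarTower S T X] [AddCommGroup N] [Module A N] (hρ : IsClosedFibre S ρ)
    (α : X →ₛₗ[ρ] N) {x : X} (hx : x ∈ maximalIdeal S • (⊤ : Submodule S X)) : α x = 0 := by
  refine Submodule.smul_induction_on hx (fun s hs y _ => ?_) fun y z hy hz => ?_
  · rw [← algebraMap_smul T, map_smulₛₗ, hρ.map_algebraMap hs, zero_smul]
  · rw [map_add, hy, hz, add_zero]

/-- A map `Y → Y₀` which is the identity on closed fibres is cocartesian if `Y₀` is flat. -/
theorem isCocartesianHom_of_fibre [IsNoetherianRing T] {S₀ T₀ : Type u} [CommRing S₀]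
    [IsLocalRing S₀] [CommRing T₀] [Algebra S₀ T₀] [IsNoetherianRing T₀] {φ : T →+* T₀}
    {ρ₀ : T₀ →+* A} (hφ : ρ₀.comp φ = ρ) {Y Y₀ M : Type u} [AddCommGroup Y] [Module S Y]
    [Module T Y] [IsScalarTower S T Y] [Module.Finite T Y] [AddCommGroup Y₀] [Module S₀ Y₀]
    [Module T₀ Y₀] [IsScalarTower S₀ T₀ Y₀] [Module.Flat S₀ Y₀] [Module.Finite T₀ Y₀]
    [AddCommGroup M] [Module A M] (hρ : IsClosedFibre S ρ) (hρ₀ : IsClosedFibre S₀ ρ₀)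
    {αY : Y →ₛₗ[ρ] M} (hY : IsFibreMap S αY) {βY : Y₀ →ₛₗ[ρ₀] M} (hY₀ : IsFibreMap S₀ βY)
    (b : Y →ₛₗ[φ] Y₀) (hb : ∀ y, βY (b y) = αY y) : IsCocartesianHom φ b := by
  let _ : Algebra T T₀ := φ.toAlgebra
  let _ : Module T Y₀ := Module.compHom Y₀ φ
  have : IsScalarTower T T₀ Y₀ := ⟨fun a b x => mul_smul (φ a) b x⟩
  have hφ' : ∀ t, ρ₀ (φ t) = ρ t := fun t => RingHom.congr_fun hφ t
  let b' : Y →ₗ[T] Y₀ := { toFun := b, map_add' := b.map_add, map_smul' := b.map_smulₛₗ }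
  let J := (maximalIdeal S₀).map (algebraMap S₀ T₀)
  let c : T₀ ⊗[T] Y →ₗ[T₀] Y₀ := b'.liftBaseChange T₀
  have hc1 : ∀ y, c (1 ⊗ₜ y) = b y := fun y => by simp [c, b']
  have hJ : ∀ t, t ∈ J ↔ ρ₀ t = 0 := fun t => by rw [← RingHom.mem_ker, hρ₀.ker_eq]
  have hsurj : Function.Surjective c := by
    rw [← LinearMap.range_eq_top, eq_top_iff]
    refine Submodule.le_of_le_smul_of_le_jacobson_bot (Module.Finite.fg_top) hρ₀.le_jacobson
      fun y₀ _ => ?_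
    obtain ⟨y, hy⟩ := hY.surjective (βY y₀)
    rw [← sub_add_cancel y₀ (b y), add_comm]
    refine Submodule.add_mem_sup ⟨1 ⊗ₜ y, hc1 y⟩ ?_
    rw [mem_map_smul_top_iff, ← hY₀.eq_zero_iff, map_sub, hb, hy, sub_self]
  have hone : ∀ z : T₀ ⊗[T] Y, ∃ y : Y,
      z - 1 ⊗ₜ y ∈ J • (⊤ : Submodule T₀ (T₀ ⊗[T] Y)) := fun z => by
    induction z with
    | zero => exact ⟨0, by simp⟩
    | tmul t₀ y =>
      obtain ⟨t, ht⟩ := hρ.surjective (ρ₀ t₀)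
      refine ⟨t • y, ?_⟩
      have h1 : t₀ ⊗ₜ[T] y - 1 ⊗ₜ (t • y) = (t₀ - φ t) • ((1 : T₀) ⊗ₜ[T] y) := by
        rw [tmul_smul, smul_tmul', ← sub_tmul, smul_tmul', smul_eq_mul, mul_one,
          Algebra.smul_def, mul_one]
        rfl
      rw [h1]
      exact Submodule.smul_mem_smul ((hJ _).mpr (by rw [map_sub, hφ', ht, sub_self])) trivial
    | add z z' hz hz' =>
      obtain ⟨y, hy⟩ := hz
      obtain ⟨y', hy'⟩ := hz'
      refine ⟨y + y', ?_⟩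
      rw [tmul_add, add_sub_add_comm]
      exact add_mem hy hy'
  have hinj : LinearMap.ker c = ⊥ := by
    refine Submodule.eq_bot_of_le_smul_of_le_jacobson_bot J _
      (Module.Finite.iff_fg.mp inferInstance) (fun z hz => ?_) hρ₀.le_jacobson
    refine mem_map_smul_ker_of_flat c hsurj _ ?_ hz
    obtain ⟨y, hy⟩ := hone z
    have hcy : b y ∈ maximalIdeal S₀ • (⊤ : Submodule S₀ Y₀) := by
      have h1 : c (z - 1 ⊗ₜ y) ∈ Submodule.map c (J • ⊤) := ⟨_, hy, rfl⟩
      rw [map_sub, LinearMap.mem_ker.mp hz, zero_sub, hc1, Submodule.map_smul'', neg_mem_iff] at h1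
      exact (mem_map_smul_top_iff _ _).mp (Submodule.smul_mono le_rfl le_top h1)
    rw [← hY₀.eq_zero_iff, hb, hY.eq_zero_iff] at hcy
    rw [← sub_add_cancel z (1 ⊗ₜ y)]
    refine add_mem hy ?_
    refine Submodule.smul_induction_on hcy (fun s hs x _ => ?_) fun x x' hx hx' => ?_
    · rw [← algebraMap_smul T s x, tmul_smul, ← algebraMap_smul T₀ (algebraMap S T s)]
      refine Submodule.smul_mem_smul ((hJ _).mpr ?_) trivial
      exact (hφ' _).trans (hρ.map_algebraMap hs)
    · rw [tmul_add]
      exact add_mem hx hx'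
  exact isBaseChange_of_bijective b' ⟨LinearMap.ker_eq_bot.mp hinj, hsurj⟩

/-- Right minimality can be tested on closed fibres. -/
theorem isRightMinimal_of_fibre [IsNoetherianRing T] {Y X M N : Type u} [AddCommGroup Y]
    [Module S Y] [Module T Y] [IsScalarTower S T Y] [Module.Finite T Y] [AddCommGroup X]
    [Module T X] [AddCommGroup M] [Module A M] [AddCommGroup N] [Module A N]
    (hρ : IsClosedFibre S ρ) {αY : Y →ₛₗ[ρ] M} (hY : IsFibreMap S αY) {αX : X →ₛₗ[ρ] N}
    (π : Y →ₗ[T] X) (p : M →ₗ[A] N) (hp : ∀ y, p (αY y) = αX (π y)) (hmin : IsRightMinimal p) :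
    IsRightMinimal π := fun g hg => by
  have hg' : ∀ y y', αY y = αY y' → αY (g y) = αY (g y') := fun y y' h => by
    rw [← sub_eq_zero, ← map_sub, ← map_sub]
    rw [← sub_eq_zero, ← map_sub, hY.eq_zero_iff] at h
    exact hρ.map_eq_zero (αY.comp g) h
  choose c hc using hY.surjective
  let γ : M →ₗ[A] M :=
    { toFun := fun m => αY (g (c m))
      map_add' := fun m m' => by
        rw [← map_add, ← map_add]
        exact hg' _ _ (by simp [hc])
      map_smul' := fun a m => by
        obtain ⟨t, rfl⟩ := hρ.surjective a
        rw [RingHom.id_apply, ← map_smulₛₗ, ← map_smul]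
        exact hg' _ _ (by simp [hc]) }
  have hγ : ∀ y, γ (αY y) = αY (g y) := fun y => hg' _ _ (hc _)
  have hbij : Function.Bijective γ := hmin γ (LinearMap.ext fun m => by
    have := LinearMap.congr_fun hg (c m)
    simp only [LinearMap.comp_apply] at this ⊢
    change p (αY (g (c m))) = p m
    rw [hp, this, ← hp, hc])
  have hsurj : Function.Surjective g := by
    rw [← LinearMap.range_eq_top, eq_top_iff]
    refine Submodule.le_of_le_smul_of_le_jacobson_bot (Module.Finite.fg_top) hρ.le_jacobson
      fun y _ => ?_
    obtain ⟨m, hm⟩ := hbij.2 (αY y)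
    obtain ⟨y', rfl⟩ := hY.surjective m
    rw [← sub_add_cancel y (g y'), add_comm]
    refine Submodule.add_mem_sup ⟨y', rfl⟩ ?_
    rw [mem_map_smul_top_iff, ← hY.eq_zero_iff, map_sub, ← hγ, hm, sub_self]
  exact ⟨IsNoetherian.injective_of_surjective_endomorphism g hsurj, hsurj⟩

theorem IsMCM.of_equiv [IsLocalRing A] {M M' : Type u} [AddCommGroup M] [Module A M]
    [AddCommGroup M'] [Module A M'] (e : M' ≃ₗ[A] M) (h : IsMCM A M) : IsMCM A M' := by
  obtain ⟨hfin, hdep⟩ := h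
  refine ⟨.equiv e.symm, ?_⟩
  have : depth A M' = depth A M := by
    simp only [depth, e.isWeaklyRegular_congr]
  rwa [this]

theorem IsFID.of_equiv {L L' : Type u} [AddCommGroup L] [Module A L] [AddCommGroup L']
    [Module A L'] (e : L' ≃ₗ[A] L) (h : IsFID A L) : IsFID A L' := by
  obtain ⟨hfin, n, hn⟩ := h
  exact ⟨.equiv e.symm, n, hasInjectiveDimensionLT_of_iso e.symm.toModuleIso _⟩

end FlatFamilies

section Constructions

variable {S T A : Type u} [CommRing S] [IsLocalRing S] [IsNoetherianRing S] [CommRing T]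
  [Algebra S T] [IsNoetherianRing T] [CommRing A] {ρ : T →+* A}
  {M N : Type u} [AddCommGroup M] [Module A M] [AddCommGroup N] [Module A N]

/-- If `ker p` is free, then `p : M → N` and a flat module `Y` with closed fibre `M` give a flat
module with closed fibre `N`, the cokernel of any lift `T^n → Y` of a basis of `ker p`. -/
theorem flat_quotient_of_lift_basis (hρ : IsClosedFibre S ρ) [Module.Flat S T]
    {Y : Type u} [AddCommGroup Y] [Module S Y] [Module T Y] [IsScalarTower S T Y] [Module.Flat S Y]
    [Module.Finite T Y] {αY : Y →ₛₗ[ρ] M} (hY : IsFibreMap S αY) (p : M →ₗ[A] N)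
    (hp : Function.Surjective p) {n : ℕ} (ℓ : Module.Basis (Fin n) A (LinearMap.ker p))
    (y : Fin n → Y) (hy : ∀ i, αY (y i) = ℓ i) :
    Module.Flat S (Y ⧸ LinearMap.range (Fintype.linearCombination T y)) ∧
    ∃ α : (Y ⧸ LinearMap.range (Fintype.linearCombination T y)) →ₛₗ[ρ] N,
      (∀ z, α (Submodule.Quotient.mk z) = p (αY z)) ∧ IsFibreMap S α := by
  have hw : ∀ t : Fin n → T, αY (Fintype.linearCombination T y t) =
      ℓ.equivFun.symm fun i => ρ (t i) := fun t => by
    simp [Fintype.linearCombination_apply, hy, Module.Basis.equivFun_symm_apply]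
  refine ⟨flat_quotient_range_of_fibre hρ.le_jacobson _ fun t ht => ?_, ?_⟩
  · rw [mem_smul_top_pi_iff, ← hρ.ker_eq]
    rw [← hY.eq_zero_iff, hw, Submodule.coe_eq_zero, LinearEquiv.map_eq_zero_iff] at ht
    exact fun i => congrFun ht i
  · have hle : LinearMap.range (Fintype.linearCombination T y) ≤ LinearMap.ker (p.comp αY) := by
      rintro _ ⟨t, rfl⟩
      rw [LinearMap.mem_ker, LinearMap.comp_apply, hw]
      exact (ℓ.equivFun.symm _).2
    refine ⟨Submodule.liftQ _ (p.comp αY) hle, fun z => rfl, fun x => ?_, fun x => ?_⟩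
    · obtain ⟨m, rfl⟩ := hp x
      obtain ⟨z, rfl⟩ := hY.surjective m
      exact ⟨Submodule.Quotient.mk z, rfl⟩
    · refine ⟨fun h => ?_, fun h => hρ.map_eq_zero _ h⟩
      obtain ⟨z, rfl⟩ := Submodule.Quotient.mk_surjective _ x
      have hz : p (αY z) = 0 := h
      choose t ht using fun i => hρ.surjective (ℓ.equivFun ⟨αY z, hz⟩ i)
      have h0 : z - Fintype.linearCombination T y t ∈ maximalIdeal S • (⊤ : Submodule S Y) := by
        rw [← hY.eq_zero_iff, map_sub, hw]
        simp only [ht]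
        rw [LinearEquiv.symm_apply_apply, sub_self]
      have h1 : Submodule.Quotient.mk (p := LinearMap.range (Fintype.linearCombination T y)) z =
          Submodule.Quotient.mk (z - Fintype.linearCombination T y t) := by
        rw [Submodule.Quotient.eq, sub_sub_cancel]
        exact ⟨t, rfl⟩
      rw [h1]
      have h2 : Submodule.map
          ((LinearMap.range (Fintype.linearCombination T y)).mkQ.restrictScalars S)
          (maximalIdeal S • ⊤) ≤ maximalIdeal S • ⊤ := by
        rw [Submodule.map_smul'']
        exact Submodule.smul_mono le_rfl le_top
      exact h2 ⟨_, h0, rfl⟩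

end Constructions
end CMDef

namespace CMDef

open IsLocalRing Abelian

section Existence

variable {S T A : Type u} [CommRing S] [IsLocalRing S] [IsNoetherianRing S] [CommRing T]
  [Algebra S T] [IsNoetherianRing T] [CommRing A] {ρ : T →+* A}
  {M N : Type u} [AddCommGroup M] [Module A M] [AddCommGroup N] [Module A N]

/-- Existence of approximations: if `ker p` is free and `Ext^2_A(N, A^n) = 0`, then every flat
module `X` with closed fibre `N` is the target of a surjection from a flat module `Y` whose closed
fibre is `p : M → N`. It is the pushout of `0 → ker q → T^r → X → 0` along a map `ker q → T^n`
which lifts the corresponding map `ker q' → ker p` over `A`. -/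
theorem exists_flat_approx (hρ : IsClosedFibre S ρ) [Module.Flat S T] {X : Type u} [AddCommGroup X]
    [Module S X] [Module T X] [IsScalarTower S T X] [Module.Flat S X] [Module.Finite T X]
    {αX : X →ₛₗ[ρ] N} (hX : IsFibreMap S αX) (p : M →ₗ[A] N) (hp : Function.Surjective p) {n : ℕ}
    (ℓ : Module.Basis (Fin n) A (LinearMap.ker p))
    (hext : ∀ (Z : Type u) [AddCommGroup Z] [Module A Z], (Z ≃ₗ[A] (Fin n → A)) →
      Subsingleton (Ext (ModuleCat.of A N) (ModuleCat.of A Z) 2)) :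
    ∃ (Y : Type u) (_ : AddCommGroup Y) (_ : Module T Y) (_ : Module S Y)
      (_ : IsScalarTower S T Y) (_ : Module.Finite T Y) (_ : Module.Flat S Y)
      (αY : Y →ₛₗ[ρ] M) (π : Y →ₗ[T] X), IsFibreMap S αY ∧ Function.Surjective π ∧
        ∀ z, p (αY z) = αX (π z) := by
  obtain ⟨r, q, hq⟩ := Module.Finite.exists_fin' T X
  have hfr : Module.Flat S (Fin r → T) := Module.Flat.trans S T _
  have hfn : Module.Flat S (Fin n → T) := Module.Flat.trans S T _
  have hfrn : Module.Flat S ((Fin r → T) × (Fin n → T)) := Module.Flat.trans S T _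
  obtain ⟨αF, hαF, hF⟩ := hρ.exists_pi r
  obtain ⟨αL, hαL, hL⟩ := hρ.exists_pi n
  choose m hm using fun i => hp (αX (q (Pi.single i 1)))
  let γ : (Fin r → A) →ₗ[A] M := Fintype.linearCombination A m
  have hγ : ∀ x, (p ∘ₗ γ) (αF x) = αX (q x) := fun x => by
    conv_rhs => rw [pi_eq_sum_univ' x]
    simp [γ, Fintype.linearCombination_apply, hαF, hm]
  have hpγ : Function.Surjective (p ∘ₗ γ) := fun z => by
    obtain ⟨x, rfl⟩ := hX.surjective z
    obtain ⟨x, rfl⟩ := hq x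
    exact ⟨αF x, hγ x⟩
  obtain ⟨αK, hαK, hK⟩ := hF.exists_ker hX q hq (p ∘ₗ γ) hγ
  have : Module.Flat S (LinearMap.ker q) := flat_ker (q.restrictScalars S) hq
  -- the map over the closed fibre, in the coordinates of `ker p`
  let h : LinearMap.ker (p ∘ₗ γ) →ₗ[A] (Fin n → A) := ℓ.equivFun.toLinearMap ∘ₗ
    (γ ∘ₗ (LinearMap.ker (p ∘ₗ γ)).subtype).codRestrict (LinearMap.ker p) fun x => x.2
  have hh : ∀ x, (ℓ.equivFun.symm (h x) : M) = γ x := fun x => by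
    simp only [h, LinearMap.comp_apply, LinearEquiv.coe_coe, LinearEquiv.symm_apply_apply]
    rfl
  -- `ker q` is flat, and `Ext^1(ker (p ∘ γ), A^n) = Ext^2(N, A^n) = 0`, so that `h` lifts
  obtain ⟨Ψ, -, hΨ⟩ : ∃ Ψ : LinearMap.ker q →ₗ[T] (Fin n → T),
      (∀ y, (0 : (Fin n → T) →ₗ[T] PUnit.{u + 1}) (Ψ y) = (0 : LinearMap.ker q →ₗ[T] _) y) ∧
        ∀ y, αL (Ψ y) = h (αK y) := by
    refine exists_lift (φ := RingHom.id T) hρ hρ hK hL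
      (βX := (0 : PUnit.{u + 1} →ₛₗ[ρ] PUnit.{u + 1}))
      ⟨fun x => ⟨0, Subsingleton.elim _ _⟩, fun x => ?_⟩ 0 (fun x => ⟨0, Subsingleton.elim _ _⟩)
      (0 : (Fin n → A) →ₗ[A] PUnit.{u + 1}) (fun y => rfl) ?_ 0 h (fun y => rfl)
    · rw [Subsingleton.elim x 0]
      exact iff_of_true rfl (zero_mem _)
    · refine subsingleton_ext_X₁ (LinearMap.shortExact_shortComplexKer hpγ) _ 1
        ?_ (hext _ ((LinearEquiv.ofEq _ _ LinearMap.ker_zero).trans Submodule.topEquiv))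
      have : HasProjectiveDimensionLT (ModuleCat.of A (Fin r → A)) 1 := inferInstance
      exact HasProjectiveDimensionLT.subsingleton (ModuleCat.of A (Fin r → A)) 1 1 le_rfl _
  let w : LinearMap.ker q →ₗ[T] (Fin r → T) × (Fin n → T) :=
    (LinearMap.ker q).subtype.prod Ψ
  let α₁ : ((Fin r → T) × (Fin n → T)) →ₛₗ[ρ] M :=
    γ.comp (αF.comp (LinearMap.fst T (Fin r → T) (Fin n → T))) -
      ((LinearMap.ker p).subtype.comp ℓ.equivFun.symm.toLinearMap).comp
        (αL.comp (LinearMap.snd T (Fin r → T) (Fin n → T)))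
  have hα₁ : ∀ z, α₁ z = γ (αF z.1) - ℓ.equivFun.symm (αL z.2) := fun z => rfl
  have hα₁w : LinearMap.range w ≤ LinearMap.ker α₁ := by
    rintro _ ⟨x, rfl⟩
    rw [LinearMap.mem_ker, hα₁]
    change γ (αF x) - ℓ.equivFun.symm (αL (Ψ x)) = 0
    rw [hΨ, hh, hαK, sub_self]
  have hπw : LinearMap.range w ≤ LinearMap.ker (q ∘ₗ LinearMap.fst T (Fin r → T) (Fin n → T)) := by
    rintro _ ⟨x, rfl⟩
    exact x.2
  have hflat : Module.Flat S (((Fin r → T) × (Fin n → T)) ⧸ LinearMap.range w) := by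
    refine flat_quotient_range_of_fibre hρ.le_jacobson w fun x hx => ?_
    have h1 : Submodule.map (LinearMap.fst S (Fin r → T) (Fin n → T)) (maximalIdeal S • ⊤) ≤
        maximalIdeal S • ⊤ := by
      rw [Submodule.map_smul'']
      exact Submodule.smul_mono le_rfl le_top
    have h2 : (x : Fin r → T) ∈ maximalIdeal S • (⊤ : Submodule S (Fin r → T)) := h1 ⟨_, hx, rfl⟩
    rw [← hK.eq_zero_iff, Subtype.ext_iff, hαK]
    exact (hF.eq_zero_iff _).mpr h2
  refine ⟨((Fin r → T) × (Fin n → T)) ⧸ LinearMap.range w, inferInstance, inferInstance,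
    inferInstance, inferInstance, inferInstance, hflat, Submodule.liftQ _ α₁ hα₁w,
    Submodule.liftQ _ _ hπw, ⟨fun x => ?_, fun x => ⟨fun hx => ?_, fun hx => hρ.map_eq_zero _ hx⟩⟩,
    fun x => ?_, fun z => ?_⟩
  · obtain ⟨a, ha⟩ := hpγ (p x)
    obtain ⟨f, rfl⟩ := hF.surjective a
    obtain ⟨t, ht⟩ := hL.surjective (ℓ.equivFun ⟨γ (αF f) - x, by
      rw [LinearMap.mem_ker, map_sub, ← ha, LinearMap.comp_apply, sub_self]⟩)
    refine ⟨Submodule.Quotient.mk (f, t), ?_⟩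
    change α₁ (f, t) = x
    rw [hα₁, ht, LinearEquiv.symm_apply_apply]
    exact sub_sub_cancel _ _
  · obtain ⟨⟨f, t⟩, rfl⟩ := Submodule.Quotient.mk_surjective _ x
    have hft : γ (αF f) - ℓ.equivFun.symm (αL t) = 0 := hx
    -- modulo `w (ker q)` the element `f` may be replaced by an element of the kernel of `αF`
    have hpf : (p ∘ₗ γ) (αF f) = 0 := by
      rw [LinearMap.comp_apply, sub_eq_zero.mp hft]
      exact (ℓ.equivFun.symm _).2
    obtain ⟨κ, hκ⟩ := hK.surjective ⟨αF f, hpf⟩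
    have hκ' : αF (f - κ) = 0 := by
      rw [map_sub, ← hαK, hκ, sub_self]
    have ht : αL (t - Ψ κ) = 0 := by
      rw [map_sub, hΨ, hκ, sub_eq_zero]
      apply ℓ.equivFun.symm.injective
      rw [Subtype.ext_iff, hh]
      exact (sub_eq_zero.mp hft).symm
    have h1 : Submodule.Quotient.mk (p := LinearMap.range w) (f, t) =
        Submodule.Quotient.mk (f - κ, t - Ψ κ) := by
      rw [Submodule.Quotient.eq]
      exact ⟨κ, by ext <;> simp [w]⟩
    rw [h1]
    have h2 : (f - κ, t - Ψ κ) ∈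
        maximalIdeal S • (⊤ : Submodule S ((Fin r → T) × (Fin n → T))) := by
      have hl : Submodule.map (LinearMap.inl S (Fin r → T) (Fin n → T)) (maximalIdeal S • ⊤) ≤
          maximalIdeal S • ⊤ := by
        rw [Submodule.map_smul'']
        exact Submodule.smul_mono le_rfl le_top
      have hr : Submodule.map (LinearMap.inr S (Fin r → T) (Fin n → T)) (maximalIdeal S • ⊤) ≤
          maximalIdeal S • ⊤ := by
        rw [Submodule.map_smul'']
        exact Submodule.smul_mono le_rfl le_top
      have := add_mem (hl ⟨_, (hF.eq_zero_iff _).mp hκ', rfl⟩)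
        (hr ⟨_, (hL.eq_zero_iff _).mp ht, rfl⟩)
      simpa using this
    have h3 : Submodule.map ((LinearMap.range w).mkQ.restrictScalars S) (maximalIdeal S • ⊤) ≤
        maximalIdeal S • ⊤ := by
      rw [Submodule.map_smul'']
      exact Submodule.smul_mono le_rfl le_top
    exact h3 ⟨_, h2, rfl⟩
  · obtain ⟨f, rfl⟩ := hq x
    exact ⟨Submodule.Quotient.mk (f, 0), rfl⟩
  · obtain ⟨⟨f, t⟩, rfl⟩ := Submodule.Quotient.mk_surjective _ z
    change p (α₁ (f, t)) = αX (q f)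
    rw [hα₁, map_sub, LinearMap.mem_ker.mp (ℓ.equivFun.symm (αL t)).2, sub_zero]
    exact hγ f

end Existence
end CMDef

namespace CMDef

/-! ### Cocartesian squares over a surjection of base rings -/

open IsLocalRing Abelian

section Squares

open Polynomial in
theorem henselianLocalRing_of_surjective {T B : Type*} [CommRing T] [HenselianLocalRing T]
    [CommRing B] [Nontrivial B] (f : T →+* B) (hf : Function.Surjective f) :
    HenselianLocalRing B := by
  have : IsLocalRing B := .of_surjective' f hf
  have hloc : IsLocalHom f := .of_surjective f hf
  refine ⟨fun P hP b hPb hP' => ?_⟩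
  obtain ⟨Q, rfl, -, hQ⟩ := lifts_and_natDegree_eq_and_monic
    ((mem_lifts P).mpr (map_surjective f hf P)) hP
  obtain ⟨t, rfl⟩ := hf b
  rw [eval_map_apply] at hPb
  rw [derivative_map, eval_map_apply] at hP'
  obtain ⟨s, hs, hst⟩ := HenselianLocalRing.is_henselian Q hQ t
    (fun h => hPb (h.map f)) (hP'.of_map f)
  refine ⟨f s, ?_, ?_⟩
  · rw [IsRoot, eval_map_apply, hs, map_zero]
  · rw [← map_sub]
    exact fun h => hst (h.of_map f)

variable {S₁ S₂ T₁ T₂ : Type u} [CommRing S₁] [CommRing S₂] [CommRing T₁] [CommRing T₂]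
  {g : S₁ →+* S₂} {h₁ : S₁ →+* T₁} {h₂ : S₂ →+* T₂} {f : T₁ →+* T₂}

/-- In a cocartesian square over a surjection with kernel `I`, the new corner is `T₁ / I T₁`, since
quotients of henselian local rings are henselian. -/
theorem IsCocartesianSquare.surjective_and_ker_eq [HenselianLocalRing T₁] [HenselianLocalRing T₂]
    (h : IsCocartesianSquare g h₁ h₂ f) (hg : Function.Surjective g) :
    Function.Surjective f ∧ RingHom.ker f = (RingHom.ker g).map h₁ := by
  obtain ⟨hcomm, hf, hh₂, huniv⟩ := h
  have hcomm' : ∀ s, f (h₁ s) = h₂ (g s) := fun s => RingHom.congr_fun hcomm s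
  have hle : (RingHom.ker g).map h₁ ≤ RingHom.ker f := by
    refine Ideal.map_le_iff_le_comap.mpr fun s hs => ?_
    rw [Ideal.mem_comap, RingHom.mem_ker, hcomm', RingHom.mem_ker.mp hs, map_zero]
  let I := (RingHom.ker g).map h₁
  have hI : I ≠ ⊤ := fun hI => RingHom.ker_ne_top f (top_le_iff.mp (hI.ge.trans hle))
  let B := T₁ ⧸ I
  have : Nontrivial B := Ideal.Quotient.nontrivial_iff.mpr hI
  let a : T₁ →+* B := Ideal.Quotient.mk I
  have ha : Function.Surjective a := Ideal.Quotient.mk_surjective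
  have : HenselianLocalRing B := henselianLocalRing_of_surjective a ha
  have hal : IsLocalHom a := .of_surjective a ha
  let b : S₂ →+* B := RingHom.liftOfSurjective g hg ⟨a.comp h₁, fun s hs =>
    Ideal.Quotient.eq_zero_iff_mem.mpr (Ideal.mem_map_of_mem h₁ hs)⟩
  have hb : ∀ s, b (g s) = a (h₁ s) := fun s => RingHom.liftOfRightInverse_comp_apply ..
  have hbl : IsLocalHom b := ⟨fun s hs => by
    obtain ⟨s, rfl⟩ := hg s
    rw [hb] at hs
    have := (hs.of_map a).map f
    rw [hcomm'] at this
    exact this.of_map h₂⟩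
  obtain ⟨c, ⟨hcl, hca, hcb⟩, -⟩ := huniv B a b hal hbl (RingHom.ext fun s => (hb s).symm)
  let d : B →+* T₂ := Ideal.Quotient.lift I f fun t ht => hle ht
  have hda : ∀ t, d (a t) = f t := fun t => Ideal.Quotient.lift_mk ..
  have hdl : IsLocalHom d := ⟨fun x hx => by
    obtain ⟨t, rfl⟩ := ha x
    rw [hda] at hx
    exact (hx.of_map f).map a⟩
  have hdc : d.comp c = RingHom.id T₂ := by
    refine (huniv T₂ f h₂ hf hh₂ hcomm).unique ⟨RingHom.isLocalHom_comp d c, ?_, ?_⟩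
      ⟨inferInstance, RingHom.id_comp _, RingHom.id_comp _⟩
    · rw [RingHom.comp_assoc, hca]
      exact RingHom.ext hda
    · rw [RingHom.comp_assoc, hcb]
      refine RingHom.ext fun s => ?_
      obtain ⟨s, rfl⟩ := hg s
      rw [RingHom.comp_apply, hb, hda, hcomm']
  refine ⟨fun z => ?_, le_antisymm (fun t ht => ?_) hle⟩
  · obtain ⟨t, ht⟩ := ha (c z)
    exact ⟨t, by rw [← hda, ht]; exact RingHom.congr_fun hdc z⟩
  · have : a t = 0 := by rw [← hca, RingHom.comp_apply, RingHom.mem_ker.mp ht, map_zero]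
    exact Ideal.Quotient.eq_zero_iff_mem.mp this

theorem IsCocartesianSquare.ringEquiv_comp (h : IsCocartesianSquare g h₁ h₂ f) {T₃ : Type u}
    [CommRing T₃] {h₃ : S₂ →+* T₃} (e : T₂ ≃+* T₃) (he : ∀ s, e (h₂ s) = h₃ s) :
    IsCocartesianSquare g h₁ h₃ (e.toRingHom.comp f) := by
  obtain ⟨hcomm, hf, hh₂, huniv⟩ := h
  have he' : e.toRingHom.comp h₂ = h₃ := RingHom.ext he
  have hel : IsLocalHom e.toRingHom := ⟨fun x hx => by
    simpa using hx.map e.symm⟩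
  have hes : IsLocalHom e.symm.toRingHom := ⟨fun x hx => by
    simpa using hx.map e⟩
  subst he'
  refine ⟨by rw [RingHom.comp_assoc, hcomm, RingHom.comp_assoc], RingHom.isLocalHom_comp _ _,
    RingHom.isLocalHom_comp _ _, fun B _ _ a b ha hb hab => ?_⟩
  obtain ⟨c, ⟨hc, hca, hcb⟩, hu⟩ := huniv B a b ha hb hab
  refine ⟨c.comp e.symm.toRingHom, ⟨RingHom.isLocalHom_comp _ _, ?_, ?_⟩, ?_⟩
  · rw [← hca]
    ext x
    simp
  · rw [← hcb]
    ext x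
    simp
  · rintro c' ⟨hc', hca', hcb'⟩
    rw [← hu (c'.comp e.toRingHom) ⟨RingHom.isLocalHom_comp _ _, hca', hcb'⟩]
    ext x
    simp

theorem IsCocartesianHom.bijective {X₁ X₂ : Type u} [AddCommGroup X₁] [Module T₁ X₁]
    [AddCommGroup X₂] [Module T₂ X₂] {α : X₁ →ₛₗ[f] X₂} (hα : IsCocartesianHom f α)
    (hf : Function.Bijective f) : Function.Bijective α := by
  let _ : Algebra T₁ T₂ := f.toAlgebra
  let _ : Module T₁ X₂ := Module.compHom X₂ f
  have : IsScalarTower T₁ T₂ X₂ := ⟨fun a b x => mul_smul (f a) b x⟩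
  obtain ⟨h₁, h₂⟩ := (isBaseChange_iff_of_surjective (B := T₂) hf.2 _).mp hα
  refine ⟨(injective_iff_map_eq_zero α).mpr fun x hx => ?_, h₁⟩
  have hk : RingHom.ker (algebraMap T₁ T₂) = ⊥ := (RingHom.injective_iff_ker_eq_bot _).mp hf.1
  simpa [hk] using (h₂ x).mp hx

end Squares

/-! ### Deformations of `N` and `M` over a deformation of `A` -/

section Deformations

variable {O : Type v} [CommRing O] {k : Type u} [Field k] [Algebra O k] {A : Type u} [CommRing A]
  [Algebra k A] {N M : Type u} [AddCommGroup N] [Module A N] [AddCommGroup M] [Module A M]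
  {S S₀ : Base O k} {f : BaseHom S S₀} {t : AlgDef A S} {t₀ : AlgDef A S₀}

/-- A deformation `T` of `A` has closed fibre `A` in the naive sense: `A = T / 𝔪_S T`. -/
theorem AlgDef.isClosedFibre [HenselianLocalRing A] (t : AlgDef A S) :
    IsClosedFibre S.carrier (algebraMap t.T A) := by
  obtain ⟨h, h'⟩ := t.cocartesian.surjective_and_ker_eq S.aug_surjective
  have hker := h'.trans (congrArg _ (ker_eq_maximalIdeal S.aug.toRingHom S.aug_surjective))
  refine ⟨h, hker, ?_⟩
  rw [← hker, jacobson_eq_maximalIdeal ⊥ bot_ne_top]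
  exact le_maximalIdeal (RingHom.ker_ne_top _)

variable [HenselianLocalRing A]

theorem ModDef.isFibreMap (x : ModDef t N) : IsFibreMap S.carrier x.toFibre :=
  (t.isClosedFibre.isCocartesianHom_iff _).mp x.cocartesian

/-- A map of deformations of `N` which is compatible with the maps to `N` is cocartesian. -/
theorem ModDef.isCocartesianHom {φ : t.T →+* t₀.T}
    (hφ : (algebraMap t₀.T A).comp φ = algebraMap t.T A) {x : ModDef t N} {x₀ : ModDef t₀ N}
    (α : x.X →ₛₗ[φ] x₀.X) (hα : ∀ y, x₀.toFibre (α y) = x.toFibre y) : IsCocartesianHom φ α :=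
  isCocartesianHom_of_fibre hφ t.isClosedFibre t₀.isClosedFibre x.isFibreMap x₀.isFibreMap α hα

theorem IsMapOver.trans_isIsoOver {t₁ : AlgDef A S₀} {φ : t.T →+* t₀.T} {x : ModDef t N}
    {x₀ : ModDef t₀ N} {x₁ : ModDef t₁ N} (h : IsMapOver f φ x x₀) {e : t₀.T ≃+* t₁.T}
    (h' : IsIsoOver e x₀ x₁) : IsMapOver f (e.toRingHom.comp φ) x x₁ := by
  obtain ⟨hsq, hφ, α, -, hα⟩ := h
  obtain ⟨h₁, h₂, ψ, hψ, hψ'⟩ := h'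
  have hφ' : (algebraMap t₁.T A).comp (e.toRingHom.comp φ) = algebraMap t.T A := by
    rw [← hφ]
    exact RingHom.ext fun a => h₂ (φ a)
  let β : x.X →ₛₗ[e.toRingHom.comp φ] x₁.X :=
    { toFun z := ψ (α z)
      map_add' z z' := by rw [map_add, map_add]
      map_smul' a z := by rw [map_smulₛₗ, hψ]; rfl }
  have hβ : ∀ z, x₁.toFibre (β z) = x.toFibre z := fun z => (hψ' _).trans (hα z)
  exact ⟨hsq.ringEquiv_comp e h₁, hφ', β, ModDef.isCocartesianHom hφ' β hβ, hβ⟩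

variable {p : M →ₗ[A] N}

/-- The conditions on the approximation of a deformation can be tested on the closed fibre. -/
theorem IsApproxMap.of_surjective (hp : IsMinimalMCMApprox p) {x : ModDef t N} {y : ModDef t M}
    {π : y.X →ₗ[t.T] x.X} (hπ : Function.Surjective π)
    (hcomm : ∀ z, p (y.toFibre z) = x.toFibre (π z)) : IsApproxMap p x y π := by
  have hρ := t.isClosedFibre
  obtain ⟨e⟩ := y.isFibreMap.exists_tensorProduct_equiv hρ
  obtain ⟨γ, -, hγ⟩ := y.isFibreMap.exists_ker x.isFibreMap π hπ p hcomm
  obtain ⟨e'⟩ := hγ.exists_tensorProduct_equiv hρ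
  exact ⟨hp.mcm.of_equiv e, hπ, flat_ker (π.restrictScalars S.carrier) hπ, hp.fid.of_equiv e',
    isRightMinimal_of_fibre hρ y.isFibreMap π p hcomm hp.minimal, hcomm⟩

/-- Every deformation of `N` has a minimal MCM approximation, if `depth N = dim A - 1`. -/
theorem exists_isApproxMap [Module.Finite A N] (hGor : IsGorensteinLocal A)
    (hp : IsMinimalMCMApprox p) (hdepth : ((depth A N : ℕ∞) : WithBot ℕ∞) + 1 = ringKrullDim A)
    (x : ModDef t N) : ∃ (y : ModDef t M) (π : y.X →ₗ[t.T] x.X), IsApproxMap p x y π := by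
  have hnoeth := hGor.2.1
  have := hp.fid.1
  have := hp.free_ker hGor hdepth
  obtain ⟨Y, _, _, _, _, _, _, αY, π, hαY, hπ, hcomm⟩ := exists_flat_approx t.isClosedFibre
    x.isFibreMap p hp.surjective (Module.finBasis A (LinearMap.ker p)) fun Z _ _ e =>
      subsingleton_ext_of_depth_add_one hdepth
        ((IsFID.pi_fin ⟨inferInstance, hGor.2.2⟩ _).of_equiv e) le_rfl
  exact ⟨{ X := Y, toFibre := αY, cocartesian := (t.isClosedFibre.isCocartesianHom_iff _).mpr hαY },
    π, .of_surjective hp hπ hcomm⟩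

/-- Maps of deformations of `N` extend to the approximations. -/
theorem IsApproxMap.exists_map (hA : IsNoetherianRing A) (hp : IsMinimalMCMApprox p)
    {φ : t.T →+* t₀.T} (hφ : (algebraMap t₀.T A).comp φ = algebraMap t.T A)
    {x : ModDef t N} {x₀ : ModDef t₀ N} {y : ModDef t M} {y₀ : ModDef t₀ M}
    {π : y.X →ₗ[t.T] x.X} {π₀ : y₀.X →ₗ[t₀.T] x₀.X} (h : IsApproxMap p x y π)
    (h₀ : IsApproxMap p x₀ y₀ π₀) (α : x.X →ₛₗ[φ] x₀.X)
    (hα : ∀ z, x₀.toFibre (α z) = x.toFibre z) :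
    ∃ β : y.X →ₛₗ[φ] y₀.X, IsCocartesianHom φ β ∧ ∀ z, y₀.toFibre (β z) = y.toFibre z := by
  have : RingHomCompTriple φ (algebraMap t₀.T A) (algebraMap t.T A) := ⟨hφ⟩
  obtain ⟨β, -, hβ⟩ := exists_lift t.isClosedFibre t₀.isClosedFibre y.isFibreMap y₀.isFibreMap
    x₀.isFibreMap π₀ h₀.surjective p h₀.comm (hp.mcm.subsingleton_ext hp.fid le_rfl)
    (α.comp π) LinearMap.id fun z => (hα _).trans (h.comm z).symm
  exact ⟨β, ModDef.isCocartesianHom hφ β hβ, hβ⟩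

/-- Approximations commute with base change. -/
theorem IsMapOver.of_isApproxMap (hA : IsNoetherianRing A) (hp : IsMinimalMCMApprox p)
    {φ : t.T →+* t₀.T} {x : ModDef t N} {x₀ : ModDef t₀ N} (hx : IsMapOver f φ x x₀)
    {y : ModDef t M} {y₀ : ModDef t₀ M} {π : y.X →ₗ[t.T] x.X} {π₀ : y₀.X →ₗ[t₀.T] x₀.X}
    (h : IsApproxMap p x y π) (h₀ : IsApproxMap p x₀ y₀ π₀) : IsMapOver f φ y y₀ := by
  obtain ⟨hsq, hφ, α, -, hα⟩ := hx
  exact ⟨hsq, hφ, h.exists_map hA hp hφ h₀ α hα⟩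

/-- Approximations of isomorphic deformations are isomorphic. -/
theorem IsIsoOver.of_isApproxMap (hA : IsNoetherianRing A) (hp : IsMinimalMCMApprox p)
    {t' : AlgDef A S} {e : t.T ≃+* t'.T} {x : ModDef t N} {x' : ModDef t' N}
    (hx : IsIsoOver e x x') {y : ModDef t M} {y' : ModDef t' M} {π : y.X →ₗ[t.T] x.X}
    {π' : y'.X →ₗ[t'.T] x'.X} (h : IsApproxMap p x y π) (h' : IsApproxMap p x' y' π') :
    IsIsoOver e y y' := by
  obtain ⟨h₁, h₂, ψ, hψ, hψ'⟩ := hx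
  obtain ⟨β, hβ, hβ'⟩ := h.exists_map (φ := e.toRingHom) hA hp (RingHom.ext h₂) h'
    { toFun := ψ, map_add' := ψ.map_add, map_smul' := hψ } hψ'
  exact ⟨h₁, h₂, AddEquiv.ofBijective β.toAddMonoidHom (hβ.bijective e.bijective),
    fun a z => map_smulₛₗ β a z, hβ'⟩

/-- Let `y` be a deformation of `M` and suppose that its base change to `S₀` approximates a
deformation `x₀` of `N`. Then `y` approximates a deformation of `N` with base change `x₀`: the
kernel of the approximation of `x₀` is free, a basis lifts to `y`, and its cokernel will do. -/
theorem exists_isApproxMap_of_isMapOver [Module.Finite A N] (hGor : IsGorensteinLocal A)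
    (hp : IsMinimalMCMApprox p) (hdepth : ((depth A N : ℕ∞) : WithBot ℕ∞) + 1 = ringKrullDim A)
    (hf : Function.Surjective f.hom) {φ : t.T →+* t₀.T} {y : ModDef t M} {y₀ : ModDef t₀ M}
    (h : IsMapOver f φ y y₀) {x₀ : ModDef t₀ N} {π₀ : y₀.X →ₗ[t₀.T] x₀.X}
    (h₀ : IsApproxMap p x₀ y₀ π₀) :
    ∃ (x : ModDef t N) (π : y.X →ₗ[t.T] x.X), IsApproxMap p x y π ∧ IsMapOver f φ x x₀ := by
  have hnoeth := hGor.2.1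
  have := hp.fid.1
  have := hp.free_ker hGor hdepth
  obtain ⟨hsq, hφ, β, hβ, hβ'⟩ := h
  have hφs := (hsq.surjective_and_ker_eq hf).1
  have hβs : Function.Surjective β := by
    let _ : Algebra t.T t₀.T := φ.toAlgebra
    let _ : Module t.T y₀.X := Module.compHom y₀.X φ
    have : IsScalarTower t.T t₀.T y₀.X := ⟨fun a b x => mul_smul (φ a) b x⟩
    exact ((isBaseChange_iff_of_surjective (B := t₀.T) hφs _).mp hβ).1
  obtain ⟨γ, hγ, hγf⟩ := y₀.isFibreMap.exists_ker x₀.isFibreMap π₀ h₀.surjective p h₀.comm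
  let ℓ := Module.finBasis A (LinearMap.ker p)
  choose z₀ hz₀ using fun i => hγf.surjective (ℓ i)
  choose z hz using fun i => hβs (z₀ i : y₀.X)
  have hzℓ : ∀ i, y.toFibre (z i) = ℓ i := fun i => by rw [← hβ', hz, ← hγ, hz₀]
  obtain ⟨hflat, αX, hαX, hαXf⟩ := flat_quotient_of_lift_basis t.isClosedFibre y.isFibreMap p
    hp.surjective ℓ z hzℓ
  let x : ModDef t N :=
    { X := y.X ⧸ LinearMap.range (Fintype.linearCombination t.T z)
      toFibre := αX
      cocartesian := (t.isClosedFibre.isCocartesianHom_iff _).mpr hαXf }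
  have hle : LinearMap.range (Fintype.linearCombination t.T z) ≤
      LinearMap.ker (π₀.comp β) := by
    rw [Fintype.range_linearCombination, Submodule.span_le]
    rintro _ ⟨i, rfl⟩
    change π₀ (β (z i)) = 0
    rw [hz]
    exact (z₀ i).2
  let α : x.X →ₛₗ[φ] x₀.X := Submodule.liftQ _ (π₀.comp β) hle
  have hα : ∀ w, x₀.toFibre (α w) = x.toFibre w := fun w => by
    obtain ⟨w, rfl⟩ := Submodule.Quotient.mk_surjective _ w
    change x₀.toFibre (π₀ (β w)) = αX (Submodule.Quotient.mk w)
    rw [hαX, ← h₀.comm, hβ']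
  exact ⟨x, Submodule.mkQ _, .of_surjective hp (Submodule.mkQ_surjective _) fun w => (hαX w).symm,
    hsq, hφ, α, ModDef.isCocartesianHom hφ α hα, hα⟩

end Deformations
end CMDef

namespace CMDef

/-! ### The maps of deformation functors -/

section Functors

variable {O : Type v} [CommRing O] {k : Type u} [Field k] [Algebra O k] {A : Type u} [CommRing A]
  {N M : Type u} [AddCommGroup N] [Module A N] [AddCommGroup M] [Module A M] [HenselianLocalRing A]
  [Module.Finite A N] {p : M →ₗ[A] N}

theorem exists_isInducedPair [Algebra k A] (hGor : IsGorensteinLocal A)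
    (hp : IsMinimalMCMApprox p)
    (hdepth : ((depth A N : ℕ∞) : WithBot ℕ∞) + 1 = ringKrullDim A) :
    ∃ σ : ∀ S : Base O k, DefPair A N S → DefPair A M S, IsInducedPair p σ ∧
      IsNatural DefPair.Maps DefPair.Maps σ ∧ IsSmooth DefPair.Maps DefPair.Maps σ := by
  have hA := hGor.2.1
  have hex {S : Base O k} (t : AlgDef A S) (x : ModDef t N) :=
    exists_isApproxMap hGor hp hdepth x
  choose Y π hπ using @hex
  let σ (S : Base O k) : DefPair A N S → DefPair A M S :=
    Quotient.lift (fun ξ => DefPair.mk ⟨ξ.alg, Y ξ.alg ξ.mod⟩) fun ξ ξ' ⟨e, he⟩ =>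
      Quotient.sound ⟨e, he.of_isApproxMap hA hp (hπ _ _) (hπ _ _)⟩
  have hσ {S : Base O k} {t : AlgDef A S} {x : ModDef t N} {y : ModDef t M}
      {q : y.X →ₗ[t.T] x.X} (hq : IsApproxMap p x y q) :
      σ S (DefPair.mk ⟨t, x⟩) = DefPair.mk ⟨t, y⟩ :=
    Quotient.sound ⟨_, (IsIsoOver.refl x).of_isApproxMap hA hp (hπ t x) hq⟩
  refine ⟨σ, fun S t x => ⟨⟨_, _, hπ t x⟩, fun y q => hσ⟩, ?_, ?_⟩
  · rintro S S₀ f _ _ ⟨ξ, ξ₀, rfl, rfl, φ, hφ⟩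
    exact ⟨_, _, (hσ (hπ _ _)).symm, (hσ (hπ _ _)).symm, φ,
      hφ.of_isApproxMap hA hp (hπ _ _) (hπ _ _)⟩
  · intro S S₀ f hf a₀ b hb
    obtain ⟨⟨t₀, x₀⟩, rfl⟩ := Quotient.exists_rep a₀
    obtain ⟨⟨t, y⟩, υ, rfl, hυ, φ, hφ⟩ := hb
    obtain ⟨e, he⟩ := Quotient.exact (hυ.trans (hσ (hπ t₀ x₀)))
    obtain ⟨x, q, hq, hx⟩ := exists_isApproxMap_of_isMapOver hGor hp hdepth hf
      (hφ.trans_isIsoOver he) (hπ t₀ x₀)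
    exact ⟨_, ⟨⟨t, x⟩, ⟨t₀, x₀⟩, rfl, rfl, _, hx⟩, hσ hq⟩

/-- In `Def^A_N` the section `A → T` is carried along unchanged, as `σ` does not change `T`. -/
theorem exists_isInducedMod [Algebra k A] (hGor : IsGorensteinLocal A)
    (hp : IsMinimalMCMApprox p)
    (hdepth : ((depth A N : ℕ∞) : WithBot ℕ∞) + 1 = ringKrullDim A) :
    ∃ σ : ∀ S : Base k k, DefMod A N S → DefMod A M S, IsInducedMod p σ ∧
      IsNatural DefMod.Maps DefMod.Maps σ ∧ IsSmooth DefMod.Maps DefMod.Maps σ := by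
  have hA := hGor.2.1
  have hex {S : Base k k} (t : TrivAlgDef A S) (x : ModDef t.toAlgDef N) :=
    exists_isApproxMap hGor hp hdepth x
  choose Y π hπ using @hex
  let σ (S : Base k k) : DefMod A N S → DefMod A M S :=
    Quotient.lift (fun ξ => DefMod.mk ⟨ξ.alg, Y ξ.alg ξ.mod⟩) fun ξ ξ' ⟨e, hei, he⟩ =>
      Quotient.sound ⟨e, hei, he.of_isApproxMap hA hp (hπ _ _) (hπ _ _)⟩
  have hσ {S : Base k k} {t : TrivAlgDef A S} {x : ModDef t.toAlgDef N} {y : ModDef t.toAlgDef M}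
      {q : y.X →ₗ[t.T] x.X} (hq : IsApproxMap p x y q) :
      σ S (DefMod.mk ⟨t, x⟩) = DefMod.mk ⟨t, y⟩ :=
    Quotient.sound ⟨_, fun _ => rfl, (IsIsoOver.refl x).of_isApproxMap hA hp (hπ t x) hq⟩
  refine ⟨σ, fun S t x => ⟨⟨_, _, hπ t x⟩, fun y q => hσ⟩, ?_, ?_⟩
  · rintro S S₀ f _ _ ⟨ξ, ξ₀, rfl, rfl, φ, hφi, hφ⟩
    exact ⟨_, _, (hσ (hπ _ _)).symm, (hσ (hπ _ _)).symm, φ, hφi,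
      hφ.of_isApproxMap hA hp (hπ _ _) (hπ _ _)⟩
  · intro S S₀ f hf a₀ b hb
    obtain ⟨⟨t₀, x₀⟩, rfl⟩ := Quotient.exists_rep a₀
    obtain ⟨⟨t, y⟩, υ, rfl, hυ, φ, hφi, hφ⟩ := hb
    obtain ⟨e, hei, he⟩ := Quotient.exact (hυ.trans (hσ (hπ t₀ x₀)))
    obtain ⟨x, q, hq, hx⟩ := exists_isApproxMap_of_isMapOver hGor hp hdepth hf
      (hφ.trans_isIsoOver he) (hπ t₀ x₀)
    refine ⟨_, ⟨⟨t, x⟩, ⟨t₀, x₀⟩, rfl, rfl, _, fun c => ?_, hx⟩, hσ hq⟩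
    exact (congrArg e (hφi c)).trans (hei c)

end Functors
end CMDef

theorem proposition8p8 {O : Type*} [CommRing O] {k : Type u} [Field k] [Algebra O k]
    {A : Type u} [CommRing A] [Algebra k A] [HenselianLocalRing A]
    (hA : CMDef.IsAlgebraicMap k A) (hGor : CMDef.IsGorensteinLocal A)
    {N M : Type u} [AddCommGroup N] [Module A N] [Module.Finite A N]
    [AddCommGroup M] [Module A M]
    (p : M →ₗ[A] N) (hp : CMDef.IsMinimalMCMApprox p)
    (hdepth : ((CMDef.depth A N : ℕ∞) : WithBot ℕ∞) + 1 = ringKrullDim A) :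
    (∃ σ : ∀ S : CMDef.Base O k, CMDef.DefPair A N S → CMDef.DefPair A M S,
      CMDef.IsInducedPair p σ ∧
      CMDef.IsNatural CMDef.DefPair.Maps CMDef.DefPair.Maps σ ∧
      CMDef.IsSmooth CMDef.DefPair.Maps CMDef.DefPair.Maps σ) ∧
    (∃ σ : ∀ S : CMDef.Base k k, CMDef.DefMod A N S → CMDef.DefMod A M S,
      CMDef.IsInducedMod p σ ∧
      CMDef.IsNatural CMDef.DefMod.Maps CMDef.DefMod.Maps σ ∧
      CMDef.IsSmooth CMDef.DefMod.Maps CMDef.DefMod.Maps σ) :=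
  ⟨CMDef.exists_isInducedPair hGor hp hdepth, CMDef.exists_isInducedMod hGor hp hdepth⟩
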